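/- Conventions. A polynomial-time algorithm is a deterministic (multi-stack) Turing machine that decides, on every input, within a number of steps bounded by a polynomial in the length of the input string. A graph on the vertices $0,\dots,n-1$ is given by its adjacency matrix; an $n\times n$ matrix with rational entries is given by the list of its entries, written as reduced fractions in binary. RIP. A vector $x\in\mathbb C^N$ is $k$-sparse if it has at most $k$ nonzero coordinates. A matrix $\Phi\in\mathbb C^{m\times N}$ satisfies the restricted isometry property of order $k$ with parameter $\delta$ if $(1-\delta)\|x\|^2\le\|\Phi x\|^2\le(1+\delta)\|x\|^2$ for every $k$-sparse $x\in\mathbb C^N$ (Euclidean norms). The RIP parameter $\delta_k(\Phi)$ of order $k$ is the least $\delta\ge 0$ for which this holds. Hypothesis $H_{1/6}$. There is no polynomial-time algorithm which, given a graph $G$ on $n$ vertices (for any $n$), (i) always outputs "yes" if $G$ contains a clique of size $\lfloor n^{1/3}\rfloor$, and (ii) outputs "no clique" with probability tending to $1$ as $n\to\infty$ when $G$ is uniformly random among the labelled graphs on $n$ vertices, i.e. drawn from $G(n,1/2)$. Theorem. Assume $H_{1/6}$. Then there is no polynomial-time algorithm which, for all sufficiently large $n$, distinguishes the $n\times n$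 rational matrices $M$ with $\delta_{k}(M)\le n^{-0.19}$ from those with $\delta_{k}(M)\ge \tfrac14 n^{-1/6}$, where $k=\lfloor n^{0.6}\rfloor$. That is, no polynomial-time algorithm with "yes"/"no" output has the property that, for all sufficiently large $n$, it answers "yes" on every $M\in\mathbb Q^{n\times n}$ with $\delta_k(M)\le n^{-0.19}$ and "no" on every $M\in\mathbb Q^{n\times n}$ with $\delta_k(M)\ge \tfrac14 n^{-1/6}$ (its answers on other matrices being arbitrary). -/

import Mathlib

open Filter Topology

/-! ### Polynomial time -/

/-- The decision procedure `f` on instances of type `α`, presented to the machine as the strings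
`enc a` over the alphabet `Γ`, is computed by a deterministic multi-stack Turing machine that halts
on every instance `a` within `p (length of enc a)` steps, for some polynomial `p`. -/
def PolyTimeDecides {α Γ : Type} (enc : α → List Γ) (f : α → Bool) : Prop :=
  Nonempty (Turing.TM2ComputableInPolyTime enc Computability.encodeBool f)

/-! ### Graphs as inputs, and the hidden clique hypothesis -/

/-- A graph on the vertices `0, …, n - 1`. -/
abbrev LabelledGraph : Type := Σ n : ℕ, SimpleGraph (Fin n)

open Classical in
/-- The adjacency matrix, row by row; each row is a string of bits closed by the end marker
`none`. -/
noncomputable def encodeGraph (G : LabelledGraph) : List (Option Bool) :=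
  (List.finRange G.1).flatMap fun i =>
    ((List.finRange G.1).map fun j => some (decide (G.2.Adj i j))) ++ [none]

/-- The probability that `f` answers `false` on a uniformly random labelled graph on `n` vertices,
that is, on a graph drawn from `G(n, 1/2)`. -/
noncomputable def probFalse (f : LabelledGraph → Bool) (n : ℕ) : ℝ :=
  ({G : SimpleGraph (Fin n) | f ⟨n, G⟩ = false}.ncard : ℝ) / Nat.card (SimpleGraph (Fin n))

/-- Hypothesis `H_ε`: no polynomial time algorithm always answers "yes" (`true`) on the graphs on
`n` vertices that contain a clique of size `⌊n ^ (1/2 - ε)⌋`, and answers "no clique" (`false`)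
with probability tending to `1` on a graph drawn from `G(n, 1/2)`. -/
def HypothesisH (ε : ℝ) : Prop :=
  ¬ ∃ f : LabelledGraph → Bool,
      PolyTimeDecides encodeGraph f ∧
      (∀ (n : ℕ) (G : SimpleGraph (Fin n)),
        (∃ s : Finset (Fin n), G.IsNClique ⌊(n : ℝ) ^ (1 / 2 - ε)⌋₊ s) → f ⟨n, G⟩ = true) ∧
      Tendsto (probFalse f) atTop (𝓝 1)

/-! ### The restricted isometry property -/

/-- `x` has at most `k` nonzero coordinates. -/
def IsSparse {N : ℕ} (k : ℕ) (x : EuclideanSpace ℂ (Fin N)) : Prop :=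
  {j | x j ≠ 0}.ncard ≤ k

/-- `Φ` satisfies the restricted isometry property of order `k` with parameter `δ`. -/
def SatisfiesRIP {m N : ℕ} (Φ : Matrix (Fin m) (Fin N) ℂ) (k : ℕ) (δ : ℝ) : Prop :=
  ∀ x : EuclideanSpace ℂ (Fin N), IsSparse k x →
    (1 - δ) * ‖x‖ ^ 2 ≤ ‖Matrix.toEuclideanLin Φ x‖ ^ 2 ∧
      ‖Matrix.toEuclideanLin Φ x‖ ^ 2 ≤ (1 + δ) * ‖x‖ ^ 2

/-- The RIP parameter of order `k` of `Φ`: the least `δ ≥ 0` for which `Φ` satisfies the restricted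
isometry property of order `k` with parameter `δ`. -/
noncomputable def ripParameter {m N : ℕ} (Φ : Matrix (Fin m) (Fin N) ℂ) (k : ℕ) : ℝ :=
  sInf {δ : ℝ | 0 ≤ δ ∧ SatisfiesRIP Φ k δ}

/-- The infimum in the definition of the RIP parameter is a minimum. -/
theorem isLeast_ripParameter {m N : ℕ} (Φ : Matrix (Fin m) (Fin N) ℂ) (k : ℕ) :
    IsLeast {δ : ℝ | 0 ≤ δ ∧ SatisfiesRIP Φ k δ} (ripParameter Φ k) := by
  have hbdd : BddBelow {δ : ℝ | 0 ≤ δ ∧ SatisfiesRIP Φ k δ} := ⟨0, fun _ h => h.1⟩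
  have hne : {δ : ℝ | 0 ≤ δ ∧ SatisfiesRIP Φ k δ}.Nonempty := by
    refine ⟨1 + ‖LinearMap.toContinuousLinearMap (Matrix.toEuclideanLin Φ)‖ ^ 2,
      by positivity, fun x _ => ?_⟩
    have h := (LinearMap.toContinuousLinearMap (Matrix.toEuclideanLin Φ)).le_opNorm x
    rw [LinearMap.coe_toContinuousLinearMap'] at h
    have h2 := pow_le_pow_left₀ (norm_nonneg _) h 2
    rw [mul_pow] at h2
    constructor
    · have := sq_nonneg ‖Matrix.toEuclideanLin Φ x‖
      have h3 : 0 ≤ ‖LinearMap.toContinuousLinearMap (Matrix.toEuclideanLin Φ)‖ ^ 2 * ‖x‖ ^ 2 := by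
        positivity
      nlinarith
    · nlinarith [sq_nonneg ‖x‖]
  have hcl : IsClosed {δ : ℝ | 0 ≤ δ ∧ SatisfiesRIP Φ k δ} := by
    have : {δ : ℝ | 0 ≤ δ ∧ SatisfiesRIP Φ k δ} = Set.Ici 0 ∩
        ⋂ (x : EuclideanSpace ℂ (Fin N)) (_ : IsSparse k x),
          ({δ : ℝ | (1 - δ) * ‖x‖ ^ 2 ≤ ‖Matrix.toEuclideanLin Φ x‖ ^ 2} ∩
            {δ : ℝ | ‖Matrix.toEuclideanLin Φ x‖ ^ 2 ≤ (1 + δ) * ‖x‖ ^ 2}) := by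
      ext δ
      simp [SatisfiesRIP]
    rw [this]
    refine isClosed_Ici.inter (isClosed_iInter fun x => isClosed_iInter fun _ => ?_)
    exact (isClosed_le (by fun_prop) (by fun_prop)).inter
      (isClosed_le (by fun_prop) (by fun_prop))
  exact hcl.isLeast_csInf hne hbdd

/-! ### Square matrices as inputs -/

/-- A square matrix with rational entries. -/
abbrev SquareRatMatrix : Type := Σ n : ℕ, Matrix (Fin n) (Fin n) ℚ

/-- The alphabet in which matrices are written. -/
inductive MatrixSymbol : Type
  | bit (b : Bool)
  | minus
  | slash
  | endEntry
  | endRow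

/-- A rational number as a reduced fraction, numerator and denominator in binary (least
significant bit first), preceded by a
minus sign if it is negative. -/
def encodeRat (q : ℚ) : List MatrixSymbol :=
  (if q < 0 then [MatrixSymbol.minus] else []) ++
    (Computability.encodeNat q.num.natAbs).map MatrixSymbol.bit ++ [MatrixSymbol.slash] ++
    (Computability.encodeNat q.den).map MatrixSymbol.bit

/-- The entries of a matrix, row by row, with end markers for the entries and for the rows. -/
def encodeMatrix (M : SquareRatMatrix) : List MatrixSymbol :=
  (List.finRange M.1).flatMap fun i =>
    ((List.finRange M.1).flatMap fun j => encodeRat (M.2 i j) ++ [MatrixSymbol.endEntry]) ++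
      [MatrixSymbol.endRow]

/-- The RIP parameter of order `k` of a rational matrix, as a complex matrix. -/
noncomputable def ratRipParameter {n : ℕ} (M : Matrix (Fin n) (Fin n) ℚ) (k : ℕ) : ℝ :=
  ripParameter (M.map ((↑) : ℚ → ℂ)) k

/-- The decision procedure `f` distinguishes the square matrices whose RIP parameter of order
`order n` is at most `low n` (answer `true`) from those whose RIP parameter of the same order is at
least `high n` (answer `false`), where `n` is the size of the matrix, for all large enough `n`.
Nothing is required of the answers on the other matrices. -/
def DistinguishesRIP (order : ℕ → ℕ) (low high : ℕ → ℝ) (f : SquareRatMatrix → Bool) : Prop :=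
  ∀ᶠ n : ℕ in atTop, ∀ M : Matrix (Fin n) (Fin n) ℚ,
    (ratRipParameter M (order n) ≤ low n → f ⟨n, M⟩ = true) ∧
      (high n ≤ ratRipParameter M (order n) → f ⟨n, M⟩ = false)

/-! The proof is a reduction. From a graph $G$ on $n$ vertices a $2n\times 2n$ rational matrix is
computed in polynomial time whose RIP parameter is small for almost every $G$ and large whenever $G$
has a clique of size $l=\lfloor n^{1/3}\rfloor$. A distinguisher composed with this map, its answer
negated, would contradict `HypothesisH`.

Let $A$ be the $\pm1$ adjacency matrix, with $-1$ on the diagonal, and $u=\lceil\sqrt n\rceil$. The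
matrix `ripMatrix` sends $(y,x)$ to $(0,x+Ay/u)$, and $\|x+Ay/u\|^2=\|x\|^2+\frac2u\langle
x,Ay\rangle+\frac1{u^2}\|Ay\|^2$. The zero rows only make the matrix square.

A clique $s$ gives $x=1_s$, $y=\pm1_s$: both vectors have squared norm $2l$, and the squared norms
of their images differ by $\frac4u(l^2-2l)$. Hence $\delta\ge(l-2)/u$, which is of order $n^{-1/6}$
(`le_ratRipParameter_of_isNClique`).

For a random graph and fixed sparse $x,y$, the form $\langle x,Ay\rangle$ is a sum of independent
signs up to its constant diagonal part, so Hoeffding's bound applies (`prob_bilin_le`). In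
$\|Ay\|^2$ the rows outside the support of $y$ are independent, and their squared sums have
subexponential tails around $\|y\|^2$ (`prob_sq_le`); the rows inside the support are controlled by
the bilinear form. A union bound over a net of $e^{O(k\log n)}$ sparse vectors shows that for large
$n$ all but a fraction $4e^{-n^{0.6}}$ of the graphs are `Typical`, and then
`Typical.ratRipParameter_le` gives $\delta=O(n^{-0.195})$.

The reduction is an explicit stack machine (`step`, `program`). It writes the matrix from its last
symbol to its first, directly onto the input stack of the distinguisher. Graphs with fewer than $N$
vertices are answered "yes", which is harmless: the clique condition only ever asks for "yes", and
the other condition is asymptotic. -/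

/-! ### Bounded reachability -/

/-- The partial step function `f` leads from `a` to `b` in at most `t` steps. -/
def ReachesWithin {α : Type*} (f : α → Option α) (t : ℕ) (a b : α) : Prop :=
  ∃ m ≤ t, (flip Bind.bind f)^[m] (some a) = some b

namespace ReachesWithin

variable {α β : Type*} {f : α → Option α}

theorem refl (t : ℕ) (a : α) : ReachesWithin f t a a := ⟨0, Nat.zero_le _, rfl⟩

theorem mono {s t : ℕ} {a b : α} (h : ReachesWithin f s a b) (hst : s ≤ t) :
    ReachesWithin f t a b := by
  obtain ⟨m, hm, h⟩ := h
  exact ⟨m, hm.trans hst, h⟩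

theorem trans {s t : ℕ} {a b c : α} (h₁ : ReachesWithin f s a b) (h₂ : ReachesWithin f t b c) :
    ReachesWithin f (s + t) a c := by
  obtain ⟨m, hm, h₁⟩ := h₁
  obtain ⟨l, hl, h₂⟩ := h₂
  exact ⟨l + m, by omega, by rw [Function.iterate_add_apply, h₁, h₂]⟩

theorem single {a b : α} (h : f a = some b) : ReachesWithin f 1 a b :=
  ⟨1, le_rfl, h⟩

theorem head {t : ℕ} {a b c : α} (h : f a = some b) (h₂ : ReachesWithin f t b c) :
    ReachesWithin f (t + 1) a c :=
  ((single h).trans h₂).mono (by omega)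

/-- Bounded reachability is transported along a simulation. -/
theorem map {g : β → Option β} {φ : α → β}
    (hφ : ∀ a a', f a = some a' → g (φ a) = some (φ a')) {t : ℕ} {a b : α}
    (h : ReachesWithin f t a b) : ReachesWithin g t (φ a) (φ b) := by
  obtain ⟨m, hm, h⟩ := h
  refine ⟨m, hm, ?_⟩
  clear hm
  induction m generalizing a with
  | zero =>
    simp only [Function.iterate_zero, id_eq, Option.some.injEq] at h ⊢
    rw [h]
  | succ m ih =>
    rw [Function.iterate_succ_apply] at h ⊢
    change (flip Bind.bind f)^[m] (f a) = _ at h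
    change (flip Bind.bind g)^[m] (g (φ a)) = _
    cases hfa : f a with
    | none =>
      rw [hfa] at h
      have : ∀ m, (flip Bind.bind f)^[m] none = none := fun m => by
        induction m with
        | zero => rfl
        | succ m ih => rw [Function.iterate_succ_apply]; exact ih
      rw [this] at h
      cases h
    | some a' =>
      rw [hφ a a' hfa]
      rw [hfa] at h
      exact ih h

end ReachesWithin

/-! ### The reduction machine, abstractly -/

namespace Reduction

/-- The labels of the reduction machine. -/
inductive Label : Type
  | read | check | incr | incrBack | round | back | main | entry | copy | copyBack | zeros
  | run | fin | cleanB | cleanC | cleanT | answer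
  deriving DecidableEq

instance : Fintype Label :=
  ⟨{.read, .check, .incr, .incrBack, .round, .back, .main, .entry, .copy, .copyBack, .zeros,
    .run, .fin, .cleanB, .cleanC, .cleanT, .answer}, fun l => by cases l <;> decide⟩

/-- The stacks of the reduction machine. -/
inductive Aux : Type
  | inp | rev | x | c | d | b | z | t | j
  deriving DecidableEq

instance : Fintype Aux :=
  ⟨{.inp, .rev, .x, .c, .d, .b, .z, .t, .j}, fun a => by cases a <;> decide⟩

/-- The contents of the stacks of the reduction machine, and the output `out` so far. -/
structure Stacks : Type where
  (inp rev x c d b z t j : List (Option Bool))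
  out : List MatrixSymbol

/-- The finite memory of the reduction machine: a counter that saturates at `N`, the last symbol
read, and a bit. -/
structure Reg (N : ℕ) : Type where
  cnt : Fin (N + 1)
  sym : Option (Option Bool)
  bit : Bool

instance {N : ℕ} : Fintype (Reg N) :=
  Fintype.ofEquiv (Fin (N + 1) × Option (Option Bool) × Bool)
    ⟨fun p => ⟨p.1, p.2.1, p.2.2⟩, fun r => (r.cnt, r.sym, r.bit), fun _ => rfl, fun _ => rfl⟩

/-- The increment of the saturating counter. -/
def satSucc {N : ℕ} (i : Fin (N + 1)) : Fin (N + 1) :=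
  ⟨min (i + 1) N, by omega⟩

/-- A configuration of the reduction machine. -/
structure Conf (N : ℕ) : Type where
  l : Label
  r : Reg N
  s : Stacks

open MatrixSymbol in
/-- The step function of the reduction machine on its own stacks. -/
def step {N : ℕ} : Conf N → Option (Conf N)
  | ⟨.read, r, s⟩ =>
    match s.inp with
    | [] => some ⟨.check, { r with sym := none }, { s with t := some true :: s.t }⟩
    | none :: l => some ⟨.read, { r with cnt := satSucc r.cnt, sym := some none },
        { s with inp := l, rev := none :: s.rev, x := none :: s.x }⟩
    | some v :: l => some ⟨.read, { r with sym := some (some v) },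
        { s with inp := l, rev := some v :: s.rev }⟩
  | ⟨.check, r, s⟩ =>
    match s.x with
    | [] => some ⟨.main, { r with sym := none }, s⟩
    | v :: l => some ⟨.incr, { r with sym := some v }, { s with x := l }⟩
  | ⟨.incr, r, s⟩ =>
    match s.b with
    | some true :: l => some ⟨.incr, { r with sym := some (some true) },
        { s with b := l, z := none :: s.z }⟩
    | l => some ⟨.incrBack, { r with sym := l.head? }, { s with b := some true :: l.tail }⟩
  | ⟨.incrBack, r, s⟩ =>
    match s.z with
    | [] => some ⟨.round, { r with sym := none }, s⟩
    | v :: l => some ⟨.incrBack, { r with sym := some v }, { s with z := l, b := some false :: s.b }⟩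
  | ⟨.round, r, s⟩ =>
    match s.c with
    | [] => some ⟨.back, { r with sym := none }, { s with d := none :: s.d }⟩
    | v :: l => some ⟨.round, { r with sym := some v },
        { s with c := l, d := none :: s.d, x := s.x.tail.tail }⟩
  | ⟨.back, r, s⟩ =>
    match s.d with
    | [] => some ⟨.check, { r with sym := none }, s⟩
    | v :: l => some ⟨.back, { r with sym := some v }, { s with d := l, c := none :: s.c }⟩
  | ⟨.main, r, s⟩ =>
    match s.rev with
    | [] => some ⟨.run, { r with sym := none }, s⟩
    | v :: l => some ⟨.entry, { r with sym := some v }, { s with rev := l, out := endRow :: s.out }⟩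
  | ⟨.entry, r, s⟩ =>
    match s.rev with
    | some v :: l =>
      if s.t.head? = some (some true) then
        some ⟨.copy, ⟨r.cnt, s.t.head?, v⟩, { s with
          rev := l, t := s.t.tail, j := some true :: s.j,
          -- The output grows at its head, so entries are written backwards: the entry $1/1$ of the
          -- identity block, then the end marker of $\pm1/u$, whose digits follow in `copyBack`.
          out := endEntry :: bit true :: slash :: bit true :: endEntry :: s.out }⟩
      else
        some ⟨.copy, ⟨r.cnt, s.t.head?, v⟩, { s with
          rev := l, t := s.t.tail, j := some false :: s.j,
          out := endEntry :: slash :: bit true :: endEntry :: s.out }⟩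
    | l => some ⟨.zeros, { r with sym := l.head? }, { s with out := endRow :: s.out }⟩
  | ⟨.copy, r, s⟩ =>
    match s.b with
    | [] => some ⟨.copyBack, { r with sym := none }, s⟩
    | v :: l => some ⟨.copy, { r with sym := some v }, { s with b := l, z := v :: s.z }⟩
  | ⟨.copyBack, r, s⟩ =>
    match s.z with
    | [] => some ⟨.entry, { r with sym := none }, { s with
        out := (if r.bit then [] else [minus]) ++ bit true :: slash :: s.out }⟩
    | v :: l => some ⟨.copyBack, { r with sym := some v },
        { s with z := l, b := v :: s.b, out := bit (v.getD false) :: s.out }⟩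
  | ⟨.zeros, r, s⟩ =>
    match s.j with
    | [] => some ⟨.main, { r with sym := none }, { s with t := some false :: s.t }⟩
    | v :: l => some ⟨.zeros, { r with sym := some v }, { s with
        j := l, t := v :: s.t,
        out := slash :: bit true :: endEntry :: slash :: bit true :: endEntry :: s.out }⟩
  | ⟨.cleanB, r, s⟩ =>
    match s.b with
    | [] => some ⟨.cleanC, { r with sym := none }, s⟩
    | v :: l => some ⟨.cleanB, { r with sym := some v }, { s with b := l }⟩
  | ⟨.cleanC, r, s⟩ =>
    match s.c with
    | [] => some ⟨.cleanT, { r with sym := none }, s⟩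
    | v :: l => some ⟨.cleanC, { r with sym := some v }, { s with c := l }⟩
  | ⟨.cleanT, r, s⟩ =>
    match s.t with
    | [] => some ⟨.answer, { r with sym := none }, s⟩
    | v :: l => some ⟨.cleanT, { r with sym := some v }, { s with t := l }⟩
  | ⟨.run, _, _⟩ => none
  | ⟨.fin, _, _⟩ => none
  | ⟨.answer, _, _⟩ => none

end Reduction

/-! ### The output phase: writing the matrix, with time bounds -/

namespace Reduction

open MatrixSymbol

variable {N : ℕ}

/-! ### Writing an entry -/

/-- Reading a stack empties it, so the digits of $u$ are moved from `b` to `z` and then back, and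
are written out on the way back. The two reversals cancel. -/
theorem copy_reaches (r : Reg N) (s : Stacks) (l : List (Option Bool)) :
    ∀ z : List (Option Bool), ReachesWithin step (l.length + 1)
      ⟨.copy, r, { s with b := l, z := z }⟩
      ⟨.copyBack, { r with sym := none }, { s with b := [], z := l.reverse ++ z }⟩ := by
  induction l generalizing r with
  | nil => exact fun z => .single rfl
  | cons v l ih =>
    intro z
    refine .head rfl ?_
    simpa using ih { r with sym := some v } (v :: z)

theorem copyBack_reaches (r : Reg N) (s : Stacks) (l : List (Option Bool)) :
    ∀ (b : List (Option Bool)) (out : List MatrixSymbol), ReachesWithin step (l.length + 1)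
      ⟨.copyBack, r, { s with z := l, b := b, out := out }⟩
      ⟨.entry, { r with sym := none }, { s with
        z := [], b := l.reverse ++ b,
        out := (if r.bit then [] else [minus]) ++ bit true :: slash ::
          (l.reverse.map (fun v => bit (v.getD false)) ++ out) }⟩ := by
  induction l generalizing r with
  | nil => exact fun b out => .single rfl
  | cons v l ih =>
    intro b out
    refine .head rfl ?_
    simpa using ih { r with sym := some v } (v :: b) (bit (v.getD false) :: out)

/-- The two entries `a / u` and `δ` of a matrix, where `u` has the binary digits `B`. -/
def cell (B : List Bool) (a δ : Bool) : List MatrixSymbol :=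
  (if a then [] else [minus]) ++ bit true :: slash :: (B.map bit ++ endEntry ::
    ((if δ then [bit true] else []) ++ [slash, bit true, endEntry]))

theorem entry_reaches (r : Reg N) (s : Stacks) (B : List Bool) (a : Bool)
    (rev t j : List (Option Bool)) (out : List MatrixSymbol) :
    ReachesWithin step (2 * B.length + 3)
      ⟨.entry, r, { s with
        rev := some a :: rev, b := B.map some, z := [], t := t, j := j, out := out }⟩
      ⟨.entry, ⟨r.cnt, none, a⟩, { s with
        rev := rev, b := B.map some, z := [], t := t.tail,
        j := some (decide (t.head? = some (some true))) :: j,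
        out := cell B a (decide (t.head? = some (some true))) ++ out }⟩ := by
  by_cases h : t.head? = some (some true)
  · have hs : ∀ o, ReachesWithin step (2 * B.length + 2)
      ⟨.copy, (⟨r.cnt, t.head?, a⟩ : Reg N), { s with
        rev := rev, b := B.map some, z := [], t := t.tail, j := some true :: j, out := o }⟩ _ :=
      fun o => ((copy_reaches _ { s with
        rev := rev, t := t.tail, j := some true :: j, out := o } (B.map some) []).trans
        (copyBack_reaches _ { s with rev := rev, t := t.tail, j := some true :: j }
          ((B.map some).reverse ++ []) [] o)).mono (by simp; omega)
    refine .head (if_pos h) ?_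
    simpa [h, cell, Function.comp_def] using hs _
  · have hs : ∀ o, ReachesWithin step (2 * B.length + 2)
      ⟨.copy, (⟨r.cnt, t.head?, a⟩ : Reg N), { s with
        rev := rev, b := B.map some, z := [], t := t.tail, j := some false :: j, out := o }⟩ _ :=
      fun o => ((copy_reaches _ { s with
        rev := rev, t := t.tail, j := some false :: j, out := o } (B.map some) []).trans
        (copyBack_reaches _ { s with rev := rev, t := t.tail, j := some false :: j }
          ((B.map some).reverse ++ []) [] o)).mono (by simp; omega)
    refine .head (if_neg h) ?_
    simpa [h, cell, Function.comp_def] using hs _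

/-! ### Writing two rows -/

/-- The stack `T` has a single `true`, at the column of the diagonal. Positions beyond its end read
as `none` and count as off the diagonal, so `T` may be shorter than a row. The bits used are saved
on `j`. -/
theorem entries_reach (s : Stacks) (B : List Bool) (a : ℕ → Bool)
    (rev T : List (Option Bool)) (m : ℕ) :
    ∀ (i : ℕ) (r : Reg N) (j : List (Option Bool)) (out : List MatrixSymbol),
      ∃ r' : Reg N, r'.cnt = r.cnt ∧ ReachesWithin step (m * (2 * B.length + 3))
        ⟨.entry, r, { s with
          rev := (List.range' i m).map (fun k => some (a k)) ++ rev, b := B.map some, z := [],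
          t := T.drop i, j := j, out := out }⟩
        ⟨.entry, r', { s with
          rev := rev, b := B.map some, z := [], t := T.drop (i + m),
          j := ((List.range' i m).map fun k => some (decide (T[k]? = some (some true)))).reverse
            ++ j,
          out := (List.range' i m).reverse.flatMap
            (fun k => cell B (a k) (decide (T[k]? = some (some true)))) ++ out }⟩ := by
  induction m with
  | zero => exact fun i r j out => ⟨r, rfl, by simpa using .refl _ _⟩
  | succ m ih =>
    intro i r j out
    have h1 := entry_reaches r s B (a i) ((List.range' (i + 1) m).map (fun k => some (a k)) ++ rev)
      (T.drop i) j out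
    rw [List.tail_drop, List.head?_drop] at h1
    obtain ⟨r', hr', h2⟩ := ih (i + 1) ⟨r.cnt, none, a i⟩ _ _
    refine ⟨r', hr', ?_⟩
    have h3 := (h1.trans h2).mono (t := (m + 1) * (2 * B.length + 3)) (by ring_nf; omega)
    simpa [List.range'_succ, List.flatMap_append, Nat.add_assoc, Nat.add_comm 1 m] using h3

/-- Two entries that are zero. -/
def zeroCell : List MatrixSymbol :=
  [slash, bit true, endEntry, slash, bit true, endEntry]

/-- While the zero row is written, `j` is moved back to `t` with one more `false` in front. This
shifts the diagonal mark by one column for the next row. -/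
theorem zeros_reach (s : Stacks) (l : List (Option Bool)) :
    ∀ (r : Reg N) (t : List (Option Bool)) (out : List MatrixSymbol),
      ReachesWithin step (l.length + 1)
        ⟨.zeros, r, { s with j := l, t := t, out := out }⟩
        ⟨.main, { r with sym := none }, { s with
          j := [], t := some false :: (l.reverse ++ t),
          out := (List.replicate l.length zeroCell).flatten ++ out }⟩ := by
  induction l with
  | nil => exact fun r t out => .single rfl
  | cons v l ih =>
    intro r t out
    refine .head rfl ?_
    have := ih { r with sym := some v } (v :: t) (zeroCell ++ out)
    simpa [List.replicate_succ', zeroCell] using this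

/-- The two rows of the output that belong to a row of the input. -/
def twoRows (n : ℕ) (B : List Bool) (a : ℕ → Bool) (r : ℕ) : List MatrixSymbol :=
  (List.replicate n zeroCell).flatten ++ endRow ::
    ((List.range n).reverse.flatMap (fun k => cell B (a k) (decide (k = r))) ++ [endRow])

/-- The invariant is that the mark of `T` sits at the index of the current row. The bound on the
length of `T` serves only to time its removal later; `hrev` ensures that `entry` stops at the end of
the row. -/
theorem row_reaches (s : Stacks) (B : List Bool) (a : ℕ → Bool) {n i : ℕ} (hi : i < n)
    {T rev : List (Option Bool)} (hT : ∀ k, T[k]? = some (some true) ↔ k = i)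
    (hTn : T.length ≤ n + i + 1) (hrev : ∀ v l, rev ≠ some v :: l) (r : Reg N)
    (out : List MatrixSymbol) :
    ∃ (r' : Reg N) (T' : List (Option Bool)), r'.cnt = r.cnt ∧
      (∀ k, T'[k]? = some (some true) ↔ k = i + 1) ∧ T'.length ≤ n + (i + 1) + 1 ∧
      ReachesWithin step (n * (2 * B.length + 3) + n + 3)
        ⟨.main, r, { s with
          rev := none :: ((List.range n).map (fun k => some (a k)) ++ rev), b := B.map some,
          z := [], t := T, j := [], out := out }⟩
        ⟨.main, r', { s with
          rev := rev, b := B.map some, z := [], t := T', j := [],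
          out := twoRows n B a i ++ out }⟩ := by
  obtain ⟨r₁, hr₁, h₁⟩ := entries_reach s B a rev T n 0 { r with sym := some none } []
    (endRow :: out)
  have h₂ : ∀ s : Stacks, s.rev = rev → step (⟨.entry, r₁, s⟩ : Conf N) =
      some ⟨.zeros, { r₁ with sym := rev.head? }, { s with out := endRow :: s.out }⟩ := by
    rintro s rfl
    rcases hs : s.rev with _ | ⟨_ | v, l⟩
    · simp [step, hs]
    · simp [step, hs]
    · exact absurd hs (hrev v l)
  have h₃ := zeros_reach { s with rev := rev, b := B.map some, z := [] }
    ((List.range n).map fun k => some (decide (k = i))).reverse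
    { r₁ with sym := rev.head? } (T.drop n) (endRow ::
      ((List.range n).reverse.flatMap (fun k => cell B (a k) (decide (k = i))) ++ endRow :: out))
  have h₄ := (h₁.trans (.head (h₂ _ rfl) (by
    simpa only [hT, ← List.range_eq_range', Nat.zero_add, List.append_nil] using h₃)))
  refine ⟨{ r₁ with sym := none }, some false ::
    ((List.range n).map (fun k => some (decide (k = i))) ++ T.drop n), hr₁, ?_, ?_, ?_⟩
  rotate_left 2
  · refine .mono (.head rfl (by simpa [← List.range_eq_range', twoRows] using h₄)) ?_
    omega
  · intro k
    rcases k with _ | k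
    · simp
    · simp only [List.getElem?_cons_succ, Nat.add_right_cancel_iff]
      by_cases hk : k < n
      · rw [List.getElem?_append_left (by simpa using hk)]
        simp [hk]
      · rw [List.getElem?_append_right (by simpa using hk), List.getElem?_drop, hT]
        simp
        omega
  · simp
    omega

theorem rows_reach (s : Stacks) (B : List Bool) (a : ℕ → ℕ → Bool) (n m : ℕ) :
    ∀ (i : ℕ) (r : Reg N) (T : List (Option Bool)) (out : List MatrixSymbol), i + m = n →
      (∀ k, T[k]? = some (some true) ↔ k = i) → T.length ≤ n + i + 1 →
      ∃ (r' : Reg N) (T' : List (Option Bool)), r'.cnt = r.cnt ∧ T'.length ≤ 2 * n + 1 ∧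
        ReachesWithin step (m * (n * (2 * B.length + 3) + n + 3) + 1)
          ⟨.main, r, { s with
            rev := (List.range' i m).flatMap
              fun i => none :: (List.range n).map fun k => some (a i k),
            b := B.map some, z := [], t := T, j := [], out := out }⟩
          ⟨.run, r', { s with
            rev := [], b := B.map some, z := [], t := T', j := [],
            out := (List.range' i m).reverse.flatMap (fun i => twoRows n B (a i) i) ++ out }⟩ := by
  induction m with
  | zero =>
    rintro i r T out rfl - hT
    exact ⟨{ r with sym := none }, T, rfl, by omega, by simpa using .single rfl⟩
  | succ m ih =>
    intro i r T out hi hT hTn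
    obtain ⟨r₁, T₁, hr₁, hT₁, hTn₁, h₁⟩ := row_reaches s B (a i) (n := n) (i := i) (by omega) hT hTn
      (rev := (List.range' (i + 1) m).flatMap
              fun i => none :: (List.range n).map fun k => some (a i k))
      (by rcases m with _ | m <;> simp [List.range'_succ]) r out
    obtain ⟨r₂, T₂, hr₂, hTn₂, h₂⟩ := ih (i + 1) r₁ T₁ (twoRows n B (a i) i ++ out) (by omega)
      hT₁ hTn₁
    refine ⟨r₂, T₂, hr₂.trans hr₁, hTn₂, ?_⟩
    have h := (h₁.trans h₂).mono (t := (m + 1) * (n * (2 * B.length + 3) + n + 3) + 1)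
      (by rw [Nat.add_mul]; omega)
    simpa [List.range'_succ, List.flatMap_append] using h

end Reduction

/-! ### The other phases: reading, binary counter, square root, emptying the stacks -/

namespace Reduction

open MatrixSymbol Computability

variable {N : ℕ}

/-! ### Reading the input -/

/-- Each row is closed by one `none`, so the marks pushed to `x` count the vertices in unary, while
the finite register counts them only up to `N`. -/
theorem read_reaches (s : Stacks) (l : List (Option Bool)) :
    ∀ (r : Reg N) (rev : List (Option Bool)) (m : ℕ),
      ∃ r' : Reg N, (r'.cnt : ℕ) = min (r.cnt + l.count none) N ∧
        ReachesWithin step (l.length + 1)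
          ⟨.read, r, { s with inp := l, rev := rev, x := List.replicate m none }⟩
          ⟨.check, r', { s with
            inp := [], rev := l.reverse ++ rev, x := List.replicate (m + l.count none) none,
            t := some true :: s.t }⟩ := by
  induction l with
  | nil =>
    exact fun r rev m => ⟨{ r with sym := none }, by simpa using by omega, .single rfl⟩
  | cons v l ih =>
    intro r rev m
    cases v with
    | none =>
      obtain ⟨r', hr', h⟩ := ih { r with cnt := satSucc r.cnt, sym := some none } (none :: rev)
        (m + 1)
      refine ⟨r', ?_, .head rfl ?_⟩
      · simp [hr', satSucc]
        omega
      · rw [List.count_cons_self, Nat.add_comm _ 1, ← Nat.add_assoc]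
        simpa [List.replicate_succ] using h
    | some v =>
      obtain ⟨r', hr', h⟩ := ih { r with sym := some (some v) } (some v :: rev) m
      exact ⟨r', by simpa using hr', .head rfl (by simpa using h)⟩

/-! ### The binary counter -/

theorem incrBack_reaches (s : Stacks) (m : ℕ) :
    ∀ (r : Reg N) (b : List (Option Bool)), ReachesWithin step (m + 1)
      ⟨.incrBack, r, { s with b := b, z := List.replicate m none }⟩
      ⟨.round, { r with sym := none }, { s with
        b := List.replicate m (some false) ++ b, z := [] }⟩ := by
  induction m with
  | zero => exact fun r b => .single rfl
  | succ m ih =>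
    intro r b
    refine .head rfl ?_
    simpa [List.replicate_succ'] using ih { r with sym := some none } (some false :: b)

theorem replicate_append_cons_self {α : Type*} (m : ℕ) (a : α) (l : List α) :
    List.replicate m a ++ a :: l = a :: (List.replicate m a ++ l) := by
  rw [List.append_cons, ← List.replicate_succ', List.replicate_succ, List.cons_append]

/-- The number `m` is the length of the carry so far: the leading `true` digits are recorded in
unary on `z` and come back as `false` digits. -/
theorem incr_reaches_posNum (s : Stacks) (p : PosNum) :
    ∀ (r : Reg N) (m : ℕ), ∃ r' : Reg N, r'.cnt = r.cnt ∧
      ReachesWithin step (2 * (encodePosNum p).length + m + 2)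
        ⟨.incr, r, { s with b := (encodePosNum p).map some, z := List.replicate m none }⟩
        ⟨.round, r', { s with
          b := List.replicate m (some false) ++ (encodePosNum p.succ).map some, z := [] }⟩ := by
  induction p with
  | one =>
    intro r m
    refine ⟨{ r with sym := none }, rfl, .mono (.head rfl (.head rfl ?_)) (s := m + 1 + 1 + 1 + 1) (by
      simp [encodePosNum]; omega)⟩
    simpa [encodePosNum, PosNum.succ, List.replicate_succ, replicate_append_cons_self] using
      incrBack_reaches s (m + 1) { r with sym := none } [some true]
  | bit1 p ih =>
    intro r m
    obtain ⟨r', hr', h⟩ := ih { r with sym := some (some true) } (m + 1)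
    refine ⟨r', hr', .mono (.head rfl (by
      simpa [encodePosNum, PosNum.succ, List.replicate_succ, replicate_append_cons_self]
        using h)) ?_⟩
    simp [encodePosNum]
    omega
  | bit0 p _ =>
    intro r m
    refine ⟨{ r with sym := none }, rfl, .mono (.head rfl (by
      simpa [encodePosNum, PosNum.succ] using incrBack_reaches s m { r with sym := some (some false) }
        (some true :: (encodePosNum p).map some))) ?_⟩
    simp [encodePosNum]

theorem length_encodePosNum_succ_le (p : PosNum) :
    (encodePosNum p.succ).length ≤ (encodePosNum p).length + 1 := by
  induction p with
  | one => simp [encodePosNum, PosNum.succ]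
  | bit1 p ih => simpa [encodePosNum, PosNum.succ] using ih
  | bit0 p _ => simp [encodePosNum, PosNum.succ]

theorem length_encodeNat_le (n : ℕ) : (encodeNat n).length ≤ n := by
  induction n with
  | zero => exact le_rfl
  | succ n ih =>
    rw [encodeNat, Nat.cast_succ, Num.add_one]
    rw [encodeNat] at ih
    cases h : (n : Num) with
    | zero => simp [encodeNum, Num.succ, Num.succ', encodePosNum]
    | pos p =>
      rw [h] at ih
      exact (length_encodePosNum_succ_le p).trans (Nat.succ_le_succ ih)

theorem incr_reaches (s : Stacks) (w : ℕ) (r : Reg N) : ∃ r' : Reg N, r'.cnt = r.cnt ∧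
    ReachesWithin step (2 * w + 2)
      ⟨.incr, r, { s with b := (encodeNat w).map some, z := [] }⟩
      ⟨.round, r', { s with b := (encodeNat (w + 1)).map some, z := [] }⟩ := by
  have hl := length_encodeNat_le w
  rw [encodeNat, encodeNat, Nat.cast_succ, Num.add_one]
  rw [encodeNat] at hl
  cases h : (w : Num) with
  | zero => exact ⟨{ r with sym := none }, rfl, .mono (.head rfl (.single rfl)) (by omega)⟩
  | pos p =>
    rw [h] at hl
    obtain ⟨r', hr', h'⟩ := incr_reaches_posNum s p r 0
    refine ⟨r', hr', .mono h' ?_⟩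
    simp only [encodeNum] at hl
    omega

/-! ### The square root -/

/-- The unary counter moves to `d` and gains a mark, and `x` loses two marks for each old one. With
the mark taken by `check`, `x` loses $2k+1=(k+1)^2-k^2$ marks. -/
theorem round_reaches (s : Stacks) (k : ℕ) :
    ∀ (r : Reg N) (m X : ℕ), ReachesWithin step (k + 1)
      ⟨.round, r, { s with
        c := List.replicate k none, d := List.replicate m none, x := List.replicate X none }⟩
      ⟨.back, { r with sym := none }, { s with
        c := [], d := List.replicate (m + k + 1) none, x := List.replicate (X - 2 * k) none }⟩ := by
  induction k with
  | zero => exact fun r m X => .single rfl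
  | succ k ih =>
    intro r m X
    refine .head rfl ?_
    have := ih { r with sym := some none } (m + 1) (X - 1 - 1)
    rw [show m + (k + 1) + 1 = m + 1 + k + 1 by omega,
      show X - 2 * (k + 1) = X - 1 - 1 - 2 * k by omega]
    simpa [List.replicate_succ] using this

theorem back_reaches (s : Stacks) (m : ℕ) :
    ∀ (r : Reg N) (k : ℕ), ReachesWithin step (m + 1)
      ⟨.back, r, { s with c := List.replicate k none, d := List.replicate m none }⟩
      ⟨.check, { r with sym := none }, { s with c := List.replicate (k + m) none, d := [] }⟩ := by
  induction m with
  | zero => exact fun r k => .single rfl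
  | succ m ih =>
    intro r k
    refine .head rfl ?_
    rw [← Nat.add_assoc, Nat.add_right_comm]
    simpa [List.replicate_succ] using ih { r with sym := some none } (k + 1)

/-- The least `u` with `n ≤ u ^ 2`. -/
def sqrtUp (n : ℕ) : ℕ :=
  Nat.find (p := fun u => n ≤ u * u) ⟨n, Nat.le_mul_self n⟩

theorem le_sqrtUp_mul_self (n : ℕ) : n ≤ sqrtUp n * sqrtUp n :=
  Nat.find_spec (p := fun u => n ≤ u * u) ⟨n, Nat.le_mul_self n⟩

theorem mul_self_lt_of_lt_sqrtUp {n w : ℕ} (h : w < sqrtUp n) : w * w < n :=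
  not_le.1 (Nat.find_min (p := fun u => n ≤ u * u) ⟨n, Nat.le_mul_self n⟩ h)

theorem sqrtUp_le (n : ℕ) : sqrtUp n ≤ n :=
  Nat.find_min' _ (Nat.le_mul_self n)

/-- The root is found by subtracting successive odd numbers. Truncated subtraction makes $n-w^2$
vanish exactly when $n\le w^2$, so the loop stops at `sqrtUp n`. A round takes at most $4w+6$ steps,
and $w<n$. -/
theorem check_reaches (s : Stacks) (n k : ℕ) :
    ∀ (r : Reg N) (w : ℕ), w + k = sqrtUp n → ∃ r' : Reg N, r'.cnt = r.cnt ∧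
      ReachesWithin step (k * (4 * n + 6) + 1)
        ⟨.check, r, { s with
          x := List.replicate (n - w * w) none, b := (encodeNat w).map some,
          c := List.replicate w none, d := [], z := [] }⟩
        ⟨.main, r', { s with
          x := [], b := (encodeNat (sqrtUp n)).map some,
          c := List.replicate (sqrtUp n) none, d := [], z := [] }⟩ := by
  induction k with
  | zero =>
    rintro r w hw
    obtain rfl : w = sqrtUp n := hw
    rw [Nat.sub_eq_zero_of_le (le_sqrtUp_mul_self n)]
    exact ⟨{ r with sym := none }, rfl, .mono (.single rfl) (by omega)⟩
  | succ k ih =>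
    intro r w hw
    have hlt := mul_self_lt_of_lt_sqrtUp (n := n) (w := w) (by omega)
    have hwn : w < n := by have := sqrtUp_le n; omega
    obtain ⟨X, hX⟩ : ∃ X, n - w * w = X + 1 := ⟨n - w * w - 1, by omega⟩
    obtain ⟨r₁, hr₁, h₁⟩ := incr_reaches { s with
      x := List.replicate X none, c := List.replicate w none, d := [] } w
      { r with sym := some none }
    have h₂ := round_reaches { s with b := (encodeNat (w + 1)).map some, z := [] } w r₁ 0 X
    have h₃ := back_reaches { s with
      b := (encodeNat (w + 1)).map some, z := [], x := List.replicate (X - 2 * w) none } (0 + w + 1)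
      { r₁ with sym := none } 0
    rw [show 0 + (0 + w + 1) = w + 1 by omega,
      show X - 2 * w = n - (w + 1) * (w + 1) by ring_nf at hX ⊢; omega] at h₃
    obtain ⟨r₂, hr₂, h₄⟩ := ih { r₁ with sym := none } (w + 1) (by omega)
    rw [hX]
    refine ⟨r₂, hr₂.trans hr₁, .mono (.head rfl (h₁.trans (h₂.trans (.trans ?_ h₄))))
      (s := 2 * w + 2 + (w + 1 + (0 + w + 1 + 1 + (k * (4 * n + 6) + 1))) + 1) ?_⟩
    · rwa [show X - 2 * w = n - (w + 1) * (w + 1) by ring_nf at hX ⊢; omega]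
    · rw [Nat.add_mul]
      omega

/-! ### Emptying the stacks -/

/-- Needed because the halting configuration `haltList` requires every stack but the output to be
empty. -/
theorem clean_reaches (s : Stacks) (b c t : List (Option Bool)) (r : Reg N) :
    ∃ r' : Reg N, r'.cnt = r.cnt ∧ r'.bit = r.bit ∧
      ReachesWithin step (b.length + c.length + t.length + 3)
        ⟨.cleanB, r, { s with b := b, c := c, t := t }⟩
        ⟨.answer, r', { s with b := [], c := [], t := [] }⟩ := by
  induction b generalizing r with
  | cons v b ih =>
    obtain ⟨r', h₁, h₂, h⟩ := ih { r with sym := some v }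
    exact ⟨r', h₁, h₂, .mono (.head rfl h) (by simp +arith)⟩
  | nil =>
    suffices H : ∀ r : Reg N, ∃ r' : Reg N, r'.cnt = r.cnt ∧ r'.bit = r.bit ∧
        ReachesWithin step (c.length + t.length + 2)
          ⟨.cleanC, r, { s with b := [], c := c, t := t }⟩
          ⟨.answer, r', { s with b := [], c := [], t := [] }⟩ by
      obtain ⟨r', h₁, h₂, h⟩ := H { r with sym := none }
      exact ⟨r', h₁, h₂, .mono (.head rfl h) (by simp +arith)⟩
    intro r
    induction c generalizing r with
    | cons v c ih =>
      obtain ⟨r', h₁, h₂, h⟩ := ih { r with sym := some v }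
      exact ⟨r', h₁, h₂, .mono (.head rfl h) (by simp +arith)⟩
    | nil =>
      suffices H : ∀ r : Reg N, ∃ r' : Reg N, r'.cnt = r.cnt ∧ r'.bit = r.bit ∧
          ReachesWithin step (t.length + 1)
            ⟨.cleanT, r, { s with b := [], c := [], t := t }⟩
            ⟨.answer, r', { s with b := [], c := [], t := [] }⟩ by
        obtain ⟨r', h₁, h₂, h⟩ := H { r with sym := none }
        exact ⟨r', h₁, h₂, .mono (.head rfl h) (by simp)⟩
      intro r
      induction t generalizing r with
      | cons v t ih =>
        obtain ⟨r', h₁, h₂, h⟩ := ih { r with sym := some v }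
        exact ⟨r', h₁, h₂, .mono (.head rfl h) (by simp)⟩
      | nil => exact ⟨{ r with sym := none }, rfl, rfl, .single rfl⟩

end Reduction

/-! ### The rational matrix of a graph and its encoding -/

namespace Reduction

open MatrixSymbol Computability

/-! ### The matrix attached to a graph -/

open Classical in
/-- The signed adjacency matrix of a graph: `1` for adjacent vertices and `-1` otherwise. -/
noncomputable def signMatrix {n : ℕ} (G : SimpleGraph (Fin n)) : Matrix (Fin n) (Fin n) ℚ :=
  fun i j => if G.Adj i j then 1 else -1

/-- The matrix of the map `(y, x) ↦ (0, A y / u + x)`, where `A` is the signed adjacency matrix and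
`u` is about the square root of the number of vertices; the coordinates of `y` and `x`
alternate. -/
noncomputable def ripMatrix {n : ℕ} (G : SimpleGraph (Fin n)) :
    Matrix (Fin (n * 2)) (Fin (n * 2)) ℚ :=
  fun p q =>
    if (finProdFinEquiv.symm p).2 = 0 then 0
    else if (finProdFinEquiv.symm q).2 = 0 then
      signMatrix G (finProdFinEquiv.symm p).1 (finProdFinEquiv.symm q).1 * (sqrtUp n : ℚ)⁻¹
    else if (finProdFinEquiv.symm p).1 = (finProdFinEquiv.symm q).1 then 1 else 0

theorem finRange_mul_two (n : ℕ) : List.finRange (n * 2) =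
    (List.finRange n).flatMap fun i => [finProdFinEquiv (i, 0), finProdFinEquiv (i, 1)] := by
  apply List.map_injective_iff.2 Fin.val_injective
  rw [List.map_flatMap, List.map_coe_finRange_eq_range]
  have : ∀ m, List.range (m * 2) = (List.range m).flatMap fun i => [2 * i, 1 + 2 * i] := by
    intro m
    induction m with
    | zero => rfl
    | succ m ih =>
      rw [Nat.add_mul, show 1 * 2 = 1 + 1 by rfl, ← Nat.add_assoc, List.range_succ, List.range_succ,
        ih, List.range_succ (n := m), List.flatMap_append]
      simp
      omega
  rw [this, ← List.map_coe_finRange_eq_range, List.flatMap_map]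
  refine List.flatMap_congr fun i _ => ?_
  simp

/-- The binary form of the numerator $0$ is the empty string, which is why the machine writes no
digit before the slash. -/
theorem encodeRat_zero : encodeRat 0 = [slash, bit true] := by
  simp [encodeRat, encodeNat, encodeNum, encodePosNum]

theorem encodeRat_one : encodeRat 1 = [bit true, slash, bit true] := by
  simp [encodeRat, encodeNat, encodeNum, encodePosNum]

theorem encodeRat_inv {u : ℕ} (hu : 0 < u) :
    encodeRat (u : ℚ)⁻¹ = bit true :: slash :: (encodeNat u).map bit := by
  have h : ¬ ((u : ℚ)⁻¹ < 0) := not_lt.2 (by positivity)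
  rw [encodeRat, if_neg h, Rat.inv_natCast_num_of_pos hu, Rat.inv_natCast_den_of_pos hu]
  simp [encodeNat, encodeNum, encodePosNum]

theorem encodeRat_neg_inv {u : ℕ} (hu : 0 < u) :
    encodeRat (-(u : ℚ)⁻¹) = minus :: bit true :: slash :: (encodeNat u).map bit := by
  have h : (-(u : ℚ)⁻¹ < 0) := by
    have : (0 : ℚ) < u := by exact_mod_cast hu
    simpa using this
  rw [encodeRat, if_pos h, Rat.neg_num, Rat.neg_den, Rat.inv_natCast_num_of_pos hu,
    Rat.inv_natCast_den_of_pos hu]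
  simp [encodeNat, encodeNum, encodePosNum]

theorem sqrtUp_pos {n : ℕ} (hn : 0 < n) : 0 < sqrtUp n := by
  have := le_sqrtUp_mul_self n
  by_contra h
  obtain h : sqrtUp n = 0 := by omega
  rw [h] at this
  omega

open Classical in
theorem cell_eq {n : ℕ} (G : SimpleGraph (Fin n)) (i j : Fin n) :
    cell (encodeNat (sqrtUp n)) (decide (G.Adj i j)) (decide (i = j)) =
      (encodeRat (ripMatrix G (finProdFinEquiv (i, 1)) (finProdFinEquiv (j, 0))) ++ [endEntry]) ++
      (encodeRat (ripMatrix G (finProdFinEquiv (i, 1)) (finProdFinEquiv (j, 1))) ++ [endEntry]) := by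
  have hu : 0 < sqrtUp n := sqrtUp_pos (Fin.pos i)
  by_cases hG : G.Adj i j <;> by_cases h : i = j <;>
    simp [cell, ripMatrix, signMatrix, hG, h, encodeRat_one, encodeRat_zero, encodeRat_inv hu,
      encodeRat_neg_inv hu]

open Classical in
/-- The rows of the input and their entries in reverse order. -/
noncomputable def revAdj {n : ℕ} (G : SimpleGraph (Fin n)) (r k : ℕ) : Bool :=
  if h : r < n ∧ k < n then decide (G.Adj (Fin.rev ⟨r, h.1⟩) (Fin.rev ⟨k, h.2⟩)) else false

open Classical in
theorem revAdj_rev {n : ℕ} (G : SimpleGraph (Fin n)) (i j : Fin n) :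
    revAdj G i.rev j.rev = decide (G.Adj i j) := by
  rw [revAdj, dif_pos ⟨i.rev.2, j.rev.2⟩]
  simp only [Fin.eta, Fin.rev_rev]

theorem range_eq_map_rev (n : ℕ) :
    (List.range n).reverse = (List.finRange n).map fun i => (i.rev : ℕ) := by
  rw [← List.map_coe_finRange_eq_range, ← List.map_reverse, List.finRange_reverse, List.map_map]
  rfl

/-- This is the content of `rev` after reading: rows and columns both come in reverse order, and the
end marker of a row now precedes it. -/
theorem reverse_encodeGraph {n : ℕ} (G : SimpleGraph (Fin n)) :
    (encodeGraph ⟨n, G⟩).reverse = (List.range n).flatMap fun r =>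
      none :: (List.range n).map fun k => some (revAdj G r k) := by
  classical
  rw [← List.reverse_inj, List.reverse_reverse, List.reverse_flatMap, range_eq_map_rev,
    List.flatMap_map, encodeGraph]
  refine List.flatMap_congr fun i _ => ?_
  simp only [Function.comp_apply, List.reverse_cons, ← List.map_reverse, range_eq_map_rev,
    List.map_map]
  congr 1
  refine List.map_congr_left fun j _ => ?_
  exact congrArg some (revAdj_rev G i j).symm

theorem encodeMatrix_ripMatrix {n : ℕ} (G : SimpleGraph (Fin n)) :
    encodeMatrix ⟨n * 2, ripMatrix G⟩ = (List.range n).reverse.flatMap fun r =>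
      twoRows n (encodeNat (sqrtUp n)) (revAdj G r) r := by
  classical
  rw [encodeMatrix, range_eq_map_rev, List.flatMap_map]
  simp only [finRange_mul_two, List.flatMap_assoc]
  refine List.flatMap_congr fun i _ => ?_
  simp only [List.flatMap_cons, List.flatMap_nil, List.append_nil, twoRows, range_eq_map_rev,
    List.flatMap_map, ← cell_eq]
  have h0 : ((List.finRange n).flatMap fun j =>
      encodeRat (ripMatrix G (finProdFinEquiv (i, 0)) (finProdFinEquiv (j, 0))) ++ [endEntry] ++
      (encodeRat (ripMatrix G (finProdFinEquiv (i, 0)) (finProdFinEquiv (j, 1))) ++ [endEntry])) =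
      (List.replicate n zeroCell).flatten := by
    have : ∀ j ∈ List.finRange n,
      encodeRat (ripMatrix G (finProdFinEquiv (i, 0)) (finProdFinEquiv (j, 0))) ++ [endEntry] ++
      (encodeRat (ripMatrix G (finProdFinEquiv (i, 0)) (finProdFinEquiv (j, 1))) ++ [endEntry]) =
        zeroCell := by
      intro j _
      simp [ripMatrix, encodeRat_zero, zeroCell]
    rw [List.flatMap_congr this, List.flatMap_def, List.map_const', List.length_finRange]
  rw [h0]
  simp only [List.append_assoc, List.cons_append, List.nil_append]
  congr 3
  refine List.flatMap_congr fun j _ => ?_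
  rw [revAdj_rev]
  congr 1
  -- Reversing both indices preserves the diagonal, so the mark on `t` is right although the rows
  -- are processed backwards.
  simp only [Fin.val_inj, Fin.rev_inj, eq_comm]

/-! ### Running the reduction -/

/-- The empty stacks. -/
def Stacks.empty : Stacks := ⟨[], [], [], [], [], [], [], [], [], []⟩

/-- The initial values of the registers. -/
def Reg.init (N : ℕ) : Reg N := ⟨0, none, false⟩

theorem length_encodeGraph {n : ℕ} (G : SimpleGraph (Fin n)) :
    (encodeGraph ⟨n, G⟩).length = n * (n + 1) := by
  simp [encodeGraph, List.length_flatMap]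

theorem count_none_encodeGraph {n : ℕ} (G : SimpleGraph (Fin n)) :
    (encodeGraph ⟨n, G⟩).count none = n := by
  have : ∀ l : List (Fin n), ∀ f : Fin n → Bool, (l.map fun j => some (f j)).count none = 0 :=
    fun l f => List.count_eq_zero.2 (by simp)
  simp [encodeGraph, List.count_flatMap, this, Function.comp_def]

theorem run_reaches {N n : ℕ} (G : SimpleGraph (Fin n)) :
    ∃ (r' : Reg N) (T : List (Option Bool)), (r'.cnt : ℕ) = min n N ∧ T.length ≤ 2 * n + 1 ∧
      ReachesWithin step (n * (n + 1) + 1 + (n * (4 * n + 6) + 1) +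
          (n * (n * (2 * n + 3) + n + 3) + 1))
        ⟨.read, Reg.init N, { Stacks.empty with inp := encodeGraph ⟨n, G⟩ }⟩
        ⟨.run, r', { Stacks.empty with
          b := (encodeNat (sqrtUp n)).map some, c := List.replicate (sqrtUp n) none, t := T,
          out := encodeMatrix ⟨n * 2, ripMatrix G⟩ }⟩ := by
  obtain ⟨r₁, hr₁, h₁⟩ := read_reaches Stacks.empty (encodeGraph ⟨n, G⟩) (Reg.init N) [] 0
  obtain ⟨r₂, hr₂, h₂⟩ := check_reaches { Stacks.empty with
    rev := (encodeGraph ⟨n, G⟩).reverse, t := [some true] } n (sqrtUp n) r₁ 0 (by simp)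
  obtain ⟨r₃, T, hr₃, hT, h₃⟩ := rows_reach { Stacks.empty with
    c := List.replicate (sqrtUp n) none } (encodeNat (sqrtUp n)) (revAdj G) n n 0 r₂
    [some true] [] (by simp) (fun k => by cases k <;> simp) (by simp)
  rw [← List.range_eq_range', ← reverse_encodeGraph, List.append_nil,
    ← encodeMatrix_ripMatrix] at h₃
  refine ⟨r₃, T, ?_, hT, ?_⟩
  · rw [hr₃, hr₂, hr₁, count_none_encodeGraph]
    simp [Reg.init]
  · have hu := sqrtUp_le n
    have hB := (length_encodeNat_le (sqrtUp n)).trans hu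
    rw [List.append_nil, count_none_encodeGraph, Nat.zero_add, length_encodeGraph] at h₁
    refine (h₁.trans (h₂.mono ?_)).trans (h₃.mono ?_) <;> gcongr

/-- The running time of the given machine is polynomial in the length of the matrix; this makes it
polynomial in $n$. -/
theorem length_encodeMatrix_le {n : ℕ} (G : SimpleGraph (Fin n)) :
    (encodeMatrix ⟨n * 2, ripMatrix G⟩).length ≤ n * (6 * n + (n * (n + 8) + 2)) := by
  have hB := (length_encodeNat_le (sqrtUp n)).trans (sqrtUp_le n)
  have hc : ∀ a δ, (cell (encodeNat (sqrtUp n)) a δ).length ≤ n + 8 := by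
    intro a δ
    rcases a <;> rcases δ <;> simp [cell] <;> omega
  have hr : ∀ a r, (twoRows n (encodeNat (sqrtUp n)) a r).length ≤
      6 * n + (n * (n + 8) + 2) := by
    intro a r
    have : ((List.range n).reverse.flatMap fun k =>
        cell (encodeNat (sqrtUp n)) (a k) (decide (k = r))).length ≤ n * (n + 8) := by
      rw [List.length_flatMap]
      refine (List.sum_le_card_nsmul _ (n + 8) ?_).trans (by simp)
      simp only [List.mem_map]
      rintro _ ⟨k, -, rfl⟩
      exact hc _ _
    have h6 : (List.replicate n zeroCell).flatten.length = 6 * n := by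
      simp [zeroCell, mul_comm]
    simp only [twoRows, List.length_append, List.length_cons, List.length_nil, h6]
    omega
  rw [encodeMatrix_ripMatrix, List.length_flatMap]
  refine (List.sum_le_card_nsmul _ (6 * n + (n * (n + 8) + 2)) ?_).trans (by simp)
  simp only [List.mem_map]
  rintro _ ⟨k, -, rfl⟩
  exact hr _ _

end Reduction

/-! ### Implementation of the abstract steps on a multi-stack machine -/

namespace Reduction

open MatrixSymbol Computability Turing

/-! ### The reduction machine as a stack machine -/

/-- The contents of the stacks, as a function. -/
def Stacks.get (s : Stacks) : Aux → List (Option Bool)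
  | .inp => s.inp
  | .rev => s.rev
  | .x => s.x
  | .c => s.c
  | .d => s.d
  | .b => s.b
  | .z => s.z
  | .t => s.t
  | .j => s.j

section Machine

variable (N : ℕ) (tm : FinTM2) (e₀ : tm.Γ tm.k₀ ≃ MatrixSymbol) (e₁ : tm.Γ tm.k₁ ≃ Bool)

/-- The alphabets of the stacks. -/
abbrev Alphabet : Aux ⊕ tm.K → Type := Sum.elim (fun _ => Option Bool) tm.Γ

/-- The statements of the reduction machine. -/
abbrev Statement : Type := TM2.Stmt (Alphabet tm) (Label ⊕ tm.Λ) (Reg N × tm.σ)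

variable {N tm}

open TM2.Stmt

/-- Move the top of a stack to the register `sym`. -/
def popSym (a : Aux) (q : Statement N tm) : Statement N tm :=
  pop (Sum.inl a) (fun v s => (⟨v.1.cnt, s, v.1.bit⟩, v.2)) q

/-- Copy the top of a stack to the register `sym`. -/
def peekSym (a : Aux) (q : Statement N tm) : Statement N tm :=
  peek (Sum.inl a) (fun v s => (⟨v.1.cnt, s, v.1.bit⟩, v.2)) q

/-- Remove the top of a stack. -/
def dropTop (a : Aux) (q : Statement N tm) : Statement N tm :=
  pop (Sum.inl a) (fun v _ => v) q

/-- Push a symbol that depends on the registers. -/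
def pushSym (a : Aux) (f : Reg N → Option Bool) (q : Statement N tm) : Statement N tm :=
  push (Sum.inl a) (fun v => f v.1) q

/-- Push a symbol to the input stack of the given machine. -/
def pushOut (m : Reg N → MatrixSymbol) (q : Statement N tm) : Statement N tm :=
  push (Sum.inr tm.k₀) (fun v => e₀.symm (m v.1)) q

/-- Test the registers. -/
def test (p : Reg N → Bool) (q₁ q₂ : Statement N tm) : Statement N tm :=
  branch (fun v => p v.1) q₁ q₂

/-- Continue at a label of the reduction machine. -/
def jump (l : Label) : Statement N tm :=
  goto fun _ => Sum.inl l

/-- The statements of the given machine, as statements of the reduction machine. -/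
def embed : TM2.Stmt tm.Γ tm.Λ tm.σ → Statement N tm
  | push k f q => push (Sum.inr k) (fun v => f v.2) (embed q)
  | peek k f q => peek (Sum.inr k) (fun v s => (v.1, f v.2 s)) (embed q)
  | pop k f q => pop (Sum.inr k) (fun v s => (v.1, f v.2 s)) (embed q)
  | load f q => load (fun v => (v.1, f v.2)) (embed q)
  | branch f q₁ q₂ => branch (fun v => f v.2) (embed q₁) (embed q₂)
  | goto f => goto fun v => Sum.inr (f v.2)
  | halt => jump .fin

/-- The program of the reduction machine at its own labels. -/
def program : Label → Statement N tm
  | .read => popSym .inp <| test (fun r => r.sym.isNone)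
      (pushSym .t (fun _ => some true) <| jump .check) <|
      test (fun r => r.sym = some none)
        (pushSym .rev (fun _ => none) <| pushSym .x (fun _ => none) <|
          load (fun v => (⟨satSucc v.1.cnt, v.1.sym, v.1.bit⟩, v.2)) <| jump .read)
        (pushSym .rev (fun r => r.sym.getD none) <| jump .read)
  | .check => popSym .x <| test (fun r => r.sym.isNone) (jump .main) (jump .incr)
  | .incr => popSym .b <| test (fun r => r.sym = some (some true))
      (pushSym .z (fun _ => none) <| jump .incr)
      (pushSym .b (fun _ => some true) <| jump .incrBack)
  | .incrBack => popSym .z <| test (fun r => r.sym.isNone) (jump .round)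
      (pushSym .b (fun _ => some false) <| jump .incrBack)
  | .round => popSym .c <| test (fun r => r.sym.isNone)
      (pushSym .d (fun _ => none) <| jump .back)
      (pushSym .d (fun _ => none) <| dropTop .x <|
        dropTop .x <| jump .round)
  | .back => popSym .d <| test (fun r => r.sym.isNone) (jump .check)
      (pushSym .c (fun _ => none) <| jump .back)
  | .main => popSym .rev <| test (fun r => r.sym.isNone) (jump .run)
      (pushOut e₀ (fun _ => endRow) <| jump .entry)
  | .entry => peekSym .rev <|
      test (fun r => (r.sym.getD none).isSome)
        (load (fun v => (⟨v.1.cnt, v.1.sym, (v.1.sym.getD none).getD false⟩, v.2)) <|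
          dropTop .rev <| popSym .t <|
          pushOut e₀ (fun _ => endEntry) <| pushOut e₀ (fun _ => bit true) <|
          pushOut e₀ (fun _ => slash) <| test (fun r => r.sym = some (some true))
            (pushSym .j (fun _ => some true) <| pushOut e₀ (fun _ => bit true) <|
              pushOut e₀ (fun _ => endEntry) <| jump .copy)
            (pushSym .j (fun _ => some false) <| pushOut e₀ (fun _ => endEntry) <| jump .copy))
        (pushOut e₀ (fun _ => endRow) <| jump .zeros)
  | .copy => popSym .b <| test (fun r => r.sym.isNone) (jump .copyBack)
      (pushSym .z (fun r => r.sym.getD none) <| jump .copy)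
  | .copyBack => popSym .z <| test (fun r => r.sym.isNone)
      (pushOut e₀ (fun _ => slash) <| pushOut e₀ (fun _ => bit true) <| test (fun r => r.bit)
        (jump .entry) (pushOut e₀ (fun _ => minus) <| jump .entry))
      (pushSym .b (fun r => r.sym.getD none) <|
        pushOut e₀ (fun r => bit ((r.sym.getD none).getD false)) <| jump .copyBack)
  | .zeros => popSym .j <| test (fun r => r.sym.isNone)
      (pushSym .t (fun _ => some false) <| jump .main)
      (pushSym .t (fun r => r.sym.getD none) <|
        pushOut e₀ (fun _ => endEntry) <| pushOut e₀ (fun _ => bit true) <|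
        pushOut e₀ (fun _ => slash) <| pushOut e₀ (fun _ => endEntry) <|
        pushOut e₀ (fun _ => bit true) <| pushOut e₀ (fun _ => slash) <| jump .zeros)
  | .cleanB => popSym .b <| test (fun r => r.sym.isNone) (jump .cleanC) (jump .cleanB)
  | .cleanC => popSym .c <| test (fun r => r.sym.isNone) (jump .cleanT) (jump .cleanC)
  | .cleanT => popSym .t <| test (fun r => r.sym.isNone) (jump .answer) (jump .cleanT)
  | .run => goto fun _ => Sum.inr tm.main
  | .fin => pop (Sum.inr tm.k₁)
      (fun v s => (⟨v.1.cnt, v.1.sym, s.elim false e₁⟩, v.2)) <| jump .cleanB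
  | .answer => push (Sum.inr tm.k₁)
      (fun v => e₁.symm (decide (v.1.cnt.val < N) || !v.1.bit)) <|
      load (fun _ => (Reg.init N, tm.initialState)) halt

variable (N) in
/-- The reduction machine followed by the given machine `tm`, whose answer is negated for inputs
with at least `N` rows and replaced by `true` for the other inputs. -/
def machine : FinTM2 :=
  letI := tm.kFin
  letI := tm.ΛFin
  letI := tm.σFin
  { K := Aux ⊕ tm.K
    k₀ := Sum.inl .inp
    k₁ := Sum.inr tm.k₁
    Γ := Alphabet tm
    Λ := Label ⊕ tm.Λ
    main := Sum.inl .read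
    σ := Reg N × tm.σ
    initialState := (Reg.init N, tm.initialState)
    Γk₀Fin := inferInstanceAs (Fintype (Option Bool))
    m := Sum.elim (program e₀ e₁) fun l => embed (tm.m l) }

/-- The stacks of the reduction machine, where the stacks of the given machine are those of `S`
except that the output `s.out` of the reduction is on top of its input stack. -/
def stk (S : ∀ k, List (tm.Γ k)) (s : Stacks) : ∀ k, List (Alphabet tm k)
  | Sum.inl a => s.get a
  | Sum.inr k => Function.update S tm.k₀ (s.out.map e₀.symm ++ S tm.k₀) k

/-- The configurations of the reduction machine at its own labels. -/
def config (S : ∀ k, List (tm.Γ k)) (c : Conf N) :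
    TM2.Cfg (Alphabet tm) (Label ⊕ tm.Λ) (Reg N × tm.σ) :=
  ⟨some (Sum.inl c.l), (c.r, tm.initialState), stk e₀ S c.s⟩

variable {e₀}

theorem update_stk_out (S : ∀ k, List (tm.Γ k)) (s : Stacks) (m : MatrixSymbol) :
    Function.update (stk e₀ S s) (Sum.inr tm.k₀)
      (e₀.symm m :: stk e₀ S s (Sum.inr tm.k₀)) =
    stk e₀ S { s with out := m :: s.out } := by
  funext k
  rcases k with a | k
  · rfl
  · by_cases h : k = tm.k₀
    · subst h
      refine (Function.update_self ..).trans ?_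
      simp [stk]
    · refine (Function.update_of_ne (by simpa using h) ..).trans ?_
      simp [stk, h]

/-- Replace the content of a stack. -/
def Stacks.set (s : Stacks) (a : Aux) (l : List (Option Bool)) : Stacks :=
  match a with
  | .inp => { s with inp := l }
  | .rev => { s with rev := l }
  | .x => { s with x := l }
  | .c => { s with c := l }
  | .d => { s with d := l }
  | .b => { s with b := l }
  | .z => { s with z := l }
  | .t => { s with t := l }
  | .j => { s with j := l }

theorem update_stk_aux (S : ∀ k, List (tm.Γ k)) (s : Stacks) (a : Aux)
    (l : List (Option Bool)) :
    Function.update (stk e₀ S s) (Sum.inl a) l = stk e₀ S (s.set a l) := by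
  funext k
  rcases k with a' | k
  · by_cases h : a' = a
    · subst h
      cases a' <;> exact Function.update_self ..
    · refine (Function.update_of_ne (by simpa using h) ..).trans ?_
      cases a <;> cases a' <;> first | rfl | exact absurd rfl h
  · cases a <;> rfl

theorem stepAux_popSym (a : Aux) (q : Statement N tm) (S : ∀ k, List (tm.Γ k)) (s : Stacks)
    (r : Reg N) (v : tm.σ) :
    TM2.stepAux (popSym a q) (r, v) (stk e₀ S s) =
      TM2.stepAux q (⟨r.cnt, (s.get a).head?, r.bit⟩, v) (stk e₀ S (s.set a (s.get a).tail)) := by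
  rw [← update_stk_aux]
  rfl

theorem stepAux_dropTop (a : Aux) (q : Statement N tm) (S : ∀ k, List (tm.Γ k)) (s : Stacks)
    (v : Reg N × tm.σ) :
    TM2.stepAux (dropTop a q) v (stk e₀ S s) =
      TM2.stepAux q v (stk e₀ S (s.set a (s.get a).tail)) := by
  rw [← update_stk_aux]
  rfl

theorem stepAux_pushSym (a : Aux) (f : Reg N → Option Bool) (q : Statement N tm)
    (S : ∀ k, List (tm.Γ k)) (s : Stacks) (r : Reg N) (v : tm.σ) :
    TM2.stepAux (pushSym a f q) (r, v) (stk e₀ S s) =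
      TM2.stepAux q (r, v) (stk e₀ S (s.set a (f r :: s.get a))) := by
  rw [← update_stk_aux]
  rfl

theorem stepAux_pushOut (m : Reg N → MatrixSymbol) (q : Statement N tm)
    (S : ∀ k, List (tm.Γ k)) (s : Stacks) (r : Reg N) (v : tm.σ) :
    TM2.stepAux (pushOut e₀ m q) (r, v) (stk e₀ S s) =
      TM2.stepAux q (r, v) (stk e₀ S { s with out := m r :: s.out }) := by
  rw [← update_stk_out]
  rfl

theorem stepAux_test (p : Reg N → Bool) (q₁ q₂ : Statement N tm)
    (T : ∀ k, List (Alphabet tm k)) (r : Reg N) (v : tm.σ) :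
    TM2.stepAux (test p q₁ q₂) (r, v) T =
      bif p r then TM2.stepAux q₁ (r, v) T else TM2.stepAux q₂ (r, v) T := rfl

theorem stepAux_jump (l : Label) (T : ∀ k, List (Alphabet tm k)) (v : Reg N × tm.σ) :
    TM2.stepAux (jump l : Statement N tm) v T = ⟨some (Sum.inl l), v, T⟩ := rfl

theorem stepAux_peekSym (a : Aux) (q : Statement N tm) (S : ∀ k, List (tm.Γ k)) (s : Stacks)
    (r : Reg N) (v : tm.σ) :
    TM2.stepAux (peekSym a q) (r, v) (stk e₀ S s) =
      TM2.stepAux q (⟨r.cnt, (s.get a).head?, r.bit⟩, v) (stk e₀ S s) := rfl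

/-- The reduction machine follows its abstract step function. -/
theorem step_config (S : ∀ k, List (tm.Γ k)) {c c' : Conf N} (h : step c = some c') :
    (machine N e₀ e₁).step (config e₀ S c) = some (config e₀ S c') := by
  obtain ⟨l, r, ⟨inp, rev, x, c, d, b, z, t, j, out⟩⟩ := c
  change some (TM2.stepAux (program e₀ e₁ l) (r, tm.initialState) (stk e₀ S _)) = _
  congr 1
  cases l
  case read =>
    rcases inp with _ | ⟨_ | v, l⟩ <;> obtain rfl := Option.some.inj h <;>
      simp [program, stepAux_popSym, stepAux_pushSym, stepAux_test, stepAux_jump, Stacks.get,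
        Stacks.set, config]
  case check =>
    rcases x with _ | ⟨v, l⟩ <;> obtain rfl := Option.some.inj h <;>
      simp [program, stepAux_popSym, stepAux_test, stepAux_jump, Stacks.get,
        Stacks.set, config]
  case incr =>
    rcases b with _ | ⟨_ | _ | _, l⟩ <;> obtain rfl := Option.some.inj h <;>
      simp [program, stepAux_popSym, stepAux_pushSym, stepAux_test, stepAux_jump, Stacks.get,
        Stacks.set, config]
  case incrBack =>
    rcases z with _ | ⟨v, l⟩ <;> obtain rfl := Option.some.inj h <;>
      simp [program, stepAux_popSym, stepAux_pushSym, stepAux_test, stepAux_jump, Stacks.get,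
        Stacks.set, config]
  case round =>
    rcases c with _ | ⟨v, l⟩ <;> obtain rfl := Option.some.inj h <;>
      simp only [program, stepAux_popSym, stepAux_pushSym, stepAux_test, stepAux_jump, stepAux_dropTop,
        Stacks.get, Stacks.set, config, List.head?_nil, List.head?_cons, List.tail_nil,
        List.tail_cons, Option.isNone_none, Option.isNone_some, cond_true, cond_false]
  case back =>
    rcases d with _ | ⟨v, l⟩ <;> obtain rfl := Option.some.inj h <;>
      simp [program, stepAux_popSym, stepAux_pushSym, stepAux_test, stepAux_jump, Stacks.get,
        Stacks.set, config]
  case main =>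
    rcases rev with _ | ⟨v, l⟩ <;> obtain rfl := Option.some.inj h <;>
      simp [program, stepAux_popSym, stepAux_pushOut, stepAux_test, stepAux_jump, Stacks.get,
        Stacks.set, config]
  case entry =>
    rcases rev with _ | ⟨_ | v, l⟩
    · obtain rfl := Option.some.inj h
      simp [program, stepAux_peekSym, stepAux_pushOut, stepAux_test, stepAux_jump, Stacks.get, config]
    · obtain rfl := Option.some.inj h
      simp [program, stepAux_peekSym, stepAux_pushOut, stepAux_test, stepAux_jump, Stacks.get, config]
    · rcases t with _ | ⟨_ | _ | _, t⟩ <;> obtain rfl := Option.some.inj h <;>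
      simp [program, stepAux_popSym, stepAux_peekSym, stepAux_pushSym, stepAux_pushOut, stepAux_test,
        stepAux_jump, stepAux_dropTop, Stacks.get, Stacks.set, config]
  case copy =>
    rcases b with _ | ⟨v, l⟩ <;> obtain rfl := Option.some.inj h <;>
      simp [program, stepAux_popSym, stepAux_pushSym, stepAux_test, stepAux_jump, Stacks.get,
        Stacks.set, config]
  case copyBack =>
    rcases z with _ | ⟨v, l⟩ <;> obtain rfl := Option.some.inj h
    · rcases hb : r.bit <;>
      simp [program, stepAux_popSym, stepAux_pushOut, stepAux_test, stepAux_jump, Stacks.get,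
        Stacks.set, config, hb]
    · simp [program, stepAux_popSym, stepAux_pushSym, stepAux_pushOut, stepAux_test, stepAux_jump,
        Stacks.get, Stacks.set, config]
  case zeros =>
    rcases j with _ | ⟨v, l⟩ <;> obtain rfl := Option.some.inj h <;>
      simp [program, stepAux_popSym, stepAux_pushSym, stepAux_pushOut, stepAux_test, stepAux_jump,
        Stacks.get, Stacks.set, config]
  case cleanB =>
    rcases b with _ | ⟨v, l⟩ <;> obtain rfl := Option.some.inj h <;>
      simp [program, stepAux_popSym, stepAux_test, stepAux_jump, Stacks.get,
        Stacks.set, config]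
  case cleanC =>
    rcases c with _ | ⟨v, l⟩ <;> obtain rfl := Option.some.inj h <;>
      simp [program, stepAux_popSym, stepAux_test, stepAux_jump, Stacks.get,
        Stacks.set, config]
  case cleanT =>
    rcases t with _ | ⟨v, l⟩ <;> obtain rfl := Option.some.inj h <;>
      simp [program, stepAux_popSym, stepAux_test, stepAux_jump, Stacks.get,
        Stacks.set, config]
  -- What remains is `run`, `fin` and `answer`, which act on the stacks of the given machine and
  -- have no abstract step.
  all_goals cases h

end Machine

end Reduction

/-! ### Composition with the given machine -/

namespace Reduction

open MatrixSymbol Computability Turing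

section Machine

variable {N : ℕ} {tm : FinTM2} {e₀ : tm.Γ tm.k₀ ≃ MatrixSymbol} {e₁ : tm.Γ tm.k₁ ≃ Bool}

/-! ### Running the given machine -/

/-- The stacks of the given machine together with those of the reduction machine. -/
def join (A : Aux → List (Option Bool)) (S : ∀ k, List (tm.Γ k)) : ∀ k, List (Alphabet tm k)
  | Sum.inl a => A a
  | Sum.inr k => S k

/-- The configurations of the given machine, as configurations of the reduction machine. -/
def embedCfg (A : Aux → List (Option Bool)) (r : Reg N) (c : TM2.Cfg tm.Γ tm.Λ tm.σ) :
    TM2.Cfg (Alphabet tm) (Label ⊕ tm.Λ) (Reg N × tm.σ) :=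
  ⟨some (c.l.elim (Sum.inl .fin) Sum.inr), (r, c.var), join A c.stk⟩

theorem update_join (A : Aux → List (Option Bool)) (S : ∀ k, List (tm.Γ k)) (k : tm.K)
    (l : List (tm.Γ k)) :
    Function.update (join A S) (Sum.inr k) l = join A (Function.update S k l) := by
  funext k'
  rcases k' with a | k'
  · rfl
  · by_cases h : k' = k
    · subst h
      refine (Function.update_self ..).trans ?_
      change l = Function.update S k' l k'
      rw [Function.update_self]
    · refine (Function.update_of_ne (by simpa using h) ..).trans ?_
      change S k' = Function.update S k l k'
      rw [Function.update_of_ne h]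

/-- An embedded statement touches neither the auxiliary stacks nor the registers of the reduction,
so these ride along as parameters. -/
theorem stepAux_embed (A : Aux → List (Option Bool)) (r : Reg N)
    (q : TM2.Stmt tm.Γ tm.Λ tm.σ) : ∀ (v : tm.σ) (S : ∀ k, List (tm.Γ k)),
    TM2.stepAux (embed q) (r, v) (join A S) = embedCfg A r (TM2.stepAux q v S) := by
  induction q with
  | push k f q ih =>
    intro v S
    rw [TM2.stepAux, ← ih, ← update_join]
    rfl
  | peek k f q ih => exact fun v S => ih _ _
  | pop k f q ih =>
    intro v S
    rw [TM2.stepAux, ← ih, ← update_join]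
    rfl
  | load f q ih => exact fun v S => ih _ _
  | branch f q₁ q₂ ih₁ ih₂ =>
    intro v S
    rw [TM2.stepAux, embed, TM2.stepAux]
    cases f v
    · exact ih₂ _ _
    · exact ih₁ _ _
  | goto f => exact fun v S => rfl
  | halt => exact fun v S => rfl

theorem step_embedCfg (A : Aux → List (Option Bool)) (r : Reg N) (c c' : tm.Cfg)
    (h : tm.step c = some c') :
    (machine N e₀ e₁).step (embedCfg A r c) = some (embedCfg A r c') := by
  obtain ⟨_ | l, v, S⟩ := c
  · cases h
  · obtain rfl := Option.some.inj h
    exact congrArg some (stepAux_embed A r (tm.m l) v S)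

theorem initList_stk (tm : FinTM2) (l : List (tm.Γ tm.k₀)) :
    (initList tm l).stk = Function.update (fun _ => []) tm.k₀ l := by
  funext k
  by_cases h : k = tm.k₀
  · subst h
    simp [initList]
  · simp [initList, h]

theorem haltList_stk (tm : FinTM2) (l : List (tm.Γ tm.k₁)) :
    (haltList tm l).stk = Function.update (fun _ => []) tm.k₁ l := by
  funext k
  by_cases h : k = tm.k₁
  · subst h
    simp [haltList]
  · simp [haltList, h]

/-- The hand-over: the output was built on the input stack of the given machine, so one jump puts
that machine in its initial configuration. -/
theorem config_eq_embed (r : Reg N) (s : Stacks) :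
    (machine N e₀ e₁).step (config e₀ (fun _ => []) ⟨.run, r, s⟩) =
      some (embedCfg s.get r (initList tm (s.out.map e₀.symm))) := by
  refine congrArg some ?_
  change TM2.Cfg.mk _ _ _ = TM2.Cfg.mk _ _ _
  congr 1
  rw [initList_stk]
  funext k
  rcases k with a | k
  · rfl
  · simp [stk, join]

theorem step_fin (r : Reg N) (s : Stacks) (hs : s.out = []) (b : Bool) :
    (machine N e₀ e₁).step (embedCfg s.get r (haltList tm [e₁.symm b])) =
      some (config e₀ (fun _ => []) ⟨.cleanB, ⟨r.cnt, r.sym, b⟩, s⟩) := by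
  refine congrArg some ?_
  change TM2.Cfg.mk _ _ _ = TM2.Cfg.mk _ _ _
  have h : join s.get (haltList tm [e₁.symm b]).stk (Sum.inr tm.k₁) = [e₁.symm b] := by
    simp [join, haltList_stk]
  rw [h]
  congr 1
  · change ((⟨r.cnt, r.sym, e₁ (e₁.symm b)⟩ : Reg N), tm.initialState) = _
    rw [Equiv.apply_symm_apply]
  · refine (update_join ..).trans ?_
    rw [haltList_stk]
    funext k
    rcases k with a | k
    · rfl
    · change Function.update (Function.update (fun _ => []) tm.k₁ [e₁.symm b]) tm.k₁ [] k = _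
      rw [Function.update_idem]
      simp [stk, hs]

theorem step_answer (r : Reg N) (s : Stacks) (hs : s = Stacks.empty) :
    (machine N e₀ e₁).step (config e₀ (fun _ => []) ⟨.answer, r, s⟩) =
      some (haltList (machine N e₀ e₁) [e₁.symm (decide (r.cnt.val < N) || !r.bit)]) := by
  refine congrArg some ?_
  change TM2.Cfg.mk _ _ _ = TM2.Cfg.mk _ _ (haltList (machine N e₀ e₁) _).stk
  congr 1
  rw [haltList_stk]
  subst hs
  funext k
  rcases k with a | k
  · cases a <;> rfl
  · by_cases h : k = tm.k₁
    · subst h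
      refine (Function.update_self ..).trans ?_
      symm
      refine (Function.update_self ..).trans ?_
      simp [stk, Stacks.empty]
      rfl
    · have h' : (Sum.inr k : Aux ⊕ tm.K) ≠ Sum.inr tm.k₁ := fun h' => h (Sum.inr.inj h')
      refine (Function.update_of_ne h' ..).trans ?_
      symm
      refine (Function.update_of_ne h' ..).trans ?_
      simp [stk, Stacks.empty]
      rfl

theorem initList_machine (l : List (Option Bool)) :
    initList (machine N e₀ e₁) l =
      config e₀ (fun _ => []) ⟨.read, Reg.init N, { Stacks.empty with inp := l }⟩ := by
  change TM2.Cfg.mk _ _ (initList (machine N e₀ e₁) l).stk = TM2.Cfg.mk _ _ _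
  congr 1
  refine (initList_stk (machine N e₀ e₁) l).trans ?_
  funext k
  rcases k with a | k
  · cases a <;> rfl
  · symm
    simp [stk, Stacks.empty]
    rfl

/-- The summand $4n+7$ consists of the three steps at `run`, `fin` and `answer` and of emptying `b`,
`c`, `t`, whose lengths are at most $n$, $n$ and $2n+1$. -/
theorem machine_reaches {n : ℕ} (G : SimpleGraph (Fin n)) (b : Bool) {t : ℕ}
    (h : ReachesWithin tm.step t
      (initList tm ((encodeMatrix ⟨n * 2, ripMatrix G⟩).map e₀.symm))
      (haltList tm [e₁.symm b])) :
    ReachesWithin (machine N e₀ e₁).step (n * (n + 1) + 1 + (n * (4 * n + 6) + 1) +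
          (n * (n * (2 * n + 3) + n + 3) + 1) + (t + (4 * n + 7)))
      (initList (machine N e₀ e₁) (encodeGraph ⟨n, G⟩))
      (haltList (machine N e₀ e₁) [e₁.symm (decide (n < N) || !b)]) := by
  obtain ⟨r₁, T, hr₁, hT, h₁⟩ := run_reaches (N := N) G
  rw [initList_machine]
  refine (h₁.map fun a a' => step_config (e₁ := e₁) _).trans ?_
  have h₂ := h.map (step_embedCfg (e₀ := e₀) (e₁ := e₁) ({ Stacks.empty with
          b := (encodeNat (sqrtUp n)).map some, c := List.replicate (sqrtUp n) none, t := T,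
          out := encodeMatrix ⟨n * 2, ripMatrix G⟩ } : Stacks).get r₁)
  obtain ⟨r₂, hr₂, hb₂, h₃⟩ := clean_reaches Stacks.empty ((encodeNat (sqrtUp n)).map some)
    (List.replicate (sqrtUp n) none) T ⟨r₁.cnt, r₁.sym, b⟩
  have h₄ := h₃.map fun a a' => step_config (e₀ := e₀) (e₁ := e₁) (fun _ => [])
  have h₅ := step_answer (e₀ := e₀) (e₁ := e₁) r₂ Stacks.empty rfl
  have hu := sqrtUp_le n
  have hB := (length_encodeNat_le (sqrtUp n)).trans hu
  -- The saturated counter holds $\min(n,N)$, which is below $N$ exactly when $n$ is.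
  rw [show decide (r₂.cnt.val < N) = decide (n < N) by
    rw [hr₂, hr₁, decide_eq_decide]; omega, hb₂] at h₅
  refine .mono (.head (config_eq_embed _ _) (h₂.trans (.head (step_fin _ { Stacks.empty with
    b := (encodeNat (sqrtUp n)).map some, c := List.replicate (sqrtUp n) none, t := T } rfl b)
    (h₄.trans (.single h₅))))) ?_
  simp
  omega

end Machine

/-- The coefficients are natural numbers. Thus bounds on lengths pass through the time polynomial.
-/
theorem eval_mono (p : Polynomial ℕ) : Monotone fun n => p.eval n := by
  intro a b hab
  simp only [Polynomial.eval_eq_sum, Polynomial.sum]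
  gcongr

/-- The reduction from graphs to matrices, as a statement about decision procedures. -/
theorem polyTimeDecides_of_ripMatrix (N : ℕ) {f : SquareRatMatrix → Bool}
    (hf : PolyTimeDecides encodeMatrix f) :
    PolyTimeDecides encodeGraph
      fun G => decide (G.1 < N) || !f ⟨G.1 * 2, ripMatrix G.2⟩ := by
  obtain ⟨⟨⟨tm, e₀, e₁⟩, p, hp⟩⟩ := hf
  have key : ∀ G : LabelledGraph, ReachesWithin (machine N e₀ e₁).step
      ((Polynomial.X * (Polynomial.X + 1) + 1 + (Polynomial.X * (4 * Polynomial.X + 6) + 1) +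
        (Polynomial.X * (Polynomial.X * (2 * Polynomial.X + 3) + Polynomial.X + 3) + 1) +
        (p.comp (Polynomial.X * (6 * Polynomial.X + (Polynomial.X * (Polynomial.X + 8) + 2))) +
          (4 * Polynomial.X + 7)) : Polynomial ℕ).eval (encodeGraph G).length)
      (initList (machine N e₀ e₁) (encodeGraph G))
      (haltList (machine N e₀ e₁)
        [e₁.symm (decide (G.1 < N) || !f ⟨G.1 * 2, ripMatrix G.2⟩)]) := by
    rintro ⟨n, G⟩
    obtain ⟨⟨m, hm⟩, hle⟩ := hp ⟨n * 2, ripMatrix G⟩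
    have hn : n ≤ (encodeGraph ⟨n, G⟩).length := by
      rw [length_encodeGraph]
      exact Nat.le_mul_of_pos_right _ (by omega)
    refine (machine_reaches G (f ⟨n * 2, ripMatrix G⟩)
      (t := p.eval (n * (6 * n + (n * (n + 8) + 2)))) ⟨m, hle.trans ?_, hm⟩).mono ?_
    · exact eval_mono p (length_encodeMatrix_le G)
    · simp only [Polynomial.eval_add, Polynomial.eval_mul, Polynomial.eval_comp, Polynomial.eval_X,
        Polynomial.eval_one, Polynomial.eval_ofNat]
      have := eval_mono p (show n * (6 * n + (n * (n + 8) + 2)) ≤ (encodeGraph ⟨n, G⟩).length *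
        (6 * (encodeGraph ⟨n, G⟩).length + ((encodeGraph ⟨n, G⟩).length *
          ((encodeGraph ⟨n, G⟩).length + 8) + 2)) by gcongr)
      simp only at this
      gcongr
  choose m hm h using key
  exact ⟨⟨⟨machine N e₀ e₁, Equiv.refl (Option Bool), e₁⟩, _, fun G =>
    ⟨⟨m G, by
      have h' := h G
      rw [← List.map_id (encodeGraph G)] at h'
      exact h'⟩, hm G⟩⟩⟩

end Reduction

/-! ### Rademacher sums -/

open scoped BigOperators

/-- The sign `±1` that belongs to a bit. -/
def sgn (b : Bool) : ℝ := if b then 1 else -1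

theorem sgn_sq (b : Bool) : sgn b ^ 2 = 1 := by cases b <;> simp [sgn]

/-! ### Exponential moments of sign sums, and probability on finite sets -/

section Rademacher

variable {ι κ : Type*} [Fintype ι] [Fintype κ] [DecidableEq ι] [DecidableEq κ]

theorem sum_pi_prod {α : Type*} [Fintype α] [DecidableEq α] (F : ι → α → ℝ) :
    ∑ ε : ι → α, ∏ i, F i (ε i) = ∏ i, ∑ a, F i a := by
  rw [Finset.prod_univ_sum, Fintype.piFinset_univ]

theorem expect_pi_prod {α : Type*} [Fintype α] [DecidableEq α] (F : ι → α → ℝ) :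
    𝔼 ε : ι → α, ∏ i, F i (ε i) = ∏ i, 𝔼 a, F i a := by
  simp only [Fintype.expect_eq_sum_div_card, sum_pi_prod, Finset.prod_div_distrib]
  simp

/-- Uniform bits restricted to a subset of the indices are again uniform; the other bits average
out. -/
theorem expect_comp_injective {φ : κ → ι} (hφ : Function.Injective φ) (g : (κ → Bool) → ℝ) :
    𝔼 ε : ι → Bool, g (ε ∘ φ) = 𝔼 η : κ → Bool, g η := by
  classical
  let e : (ι → Bool) ≃ (κ → Bool) × ({x // x ∉ Set.range φ} → Bool) :=
    (Equiv.piEquivPiSubtypeProd (· ∈ Set.range φ) fun _ => Bool).trans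
      (Equiv.prodCongr ((Equiv.ofInjective φ hφ).arrowCongr (Equiv.refl Bool)).symm
        (Equiv.refl _))
  have he : ∀ ε, (e ε).1 = ε ∘ φ := fun ε => rfl
  calc 𝔼 ε : ι → Bool, g (ε ∘ φ)
      = 𝔼 p : (κ → Bool) × ({x // x ∉ Set.range φ} → Bool), g p.1 :=
        Fintype.expect_equiv e _ _ fun ε => by rw [he]
    _ = 𝔼 η : κ → Bool, g η := by
        rw [← Finset.univ_product_univ, Finset.expect_product]
        simp

/-- Independence turns the mean into $\prod_i\cosh c_i$, and $\cosh c\le e^{c^2/2}$. -/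
theorem expect_exp_sum_sgn_le (c : ι → ℝ) :
    𝔼 ε : ι → Bool, Real.exp (∑ i, c i * sgn (ε i)) ≤ Real.exp ((∑ i, c i ^ 2) / 2) := by
  simp only [Real.exp_sum]
  rw [expect_pi_prod (fun i b => Real.exp (c i * sgn b)), Finset.sum_div, Real.exp_sum]
  refine Finset.prod_le_prod (fun i _ => ?_) fun i _ => ?_
  · exact Finset.expect_nonneg fun b _ => (Real.exp_pos _).le
  · refine le_trans (le_of_eq ?_) (Real.cosh_le_exp_half_sq (c i))
    rw [Fintype.expect_eq_sum_div_card]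
    simp [sgn, Real.cosh_eq]

theorem expect_sgn_mul_sgn (i j : ι) :
    𝔼 ε : ι → Bool, sgn (ε i) * sgn (ε j) = if i = j then 1 else 0 := by
  split_ifs with h
  · subst h
    simp [← sq, sgn_sq]
  · have := expect_pi_prod (ι := ι) (α := Bool)
      fun k b => if k = i ∨ k = j then sgn b else 1
    have h2 : ∀ ε : ι → Bool, ∏ k, (if k = i ∨ k = j then sgn (ε k) else 1) =
        sgn (ε i) * sgn (ε j) := by
      intro ε
      rw [← Finset.prod_filter, show Finset.univ.filter (fun k => k = i ∨ k = j) = {i, j} by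
        ext; simp, Finset.prod_pair h]
    simp only [h2] at this
    rw [this]
    refine Finset.prod_eq_zero (Finset.mem_univ i) ?_
    rw [Fintype.expect_eq_sum_div_card]
    simp [sgn]

theorem expect_sum_sgn_sq (w : ι → ℝ) :
    𝔼 ε : ι → Bool, (∑ i, w i * sgn (ε i)) ^ 2 = ∑ i, w i ^ 2 := by
  have : ∀ ε : ι → Bool, (∑ i, w i * sgn (ε i)) ^ 2 =
      ∑ i, ∑ j, w i * w j * (sgn (ε i) * sgn (ε j)) := by
    intro ε
    rw [sq, Finset.sum_mul_sum]
    exact Finset.sum_congr rfl fun i _ => Finset.sum_congr rfl fun j _ => by ring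
  simp only [this, Finset.expect_sum_comm, ← Finset.mul_expect, expect_sgn_mul_sgn]
  simp [sq]

theorem exp_sq_div_four_eq (y : ℝ) :
    MeasureTheory.Integrable (fun g : ℝ => Real.exp (-g ^ 2 + g * y)) ∧
      ∫ g : ℝ, Real.exp (-g ^ 2 + g * y) = √Real.pi * Real.exp (y ^ 2 / 4) := by
  have h : (fun g : ℝ => Real.exp (-g ^ 2 + g * y)) =
      fun g => Real.exp (-1 * (g - y / 2) ^ 2) * Real.exp (y ^ 2 / 4) := by
    funext g
    rw [← Real.exp_add]
    congr 1
    ring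
  rw [h]
  constructor
  · exact ((integrable_exp_neg_mul_sq one_pos).comp_sub_right (y / 2)).mul_const _
  · rw [MeasureTheory.integral_mul_const,
      MeasureTheory.integral_sub_right_eq_self (fun g : ℝ => Real.exp (-1 * g ^ 2)),
      integral_gaussian, div_one]

/-- Gaussian linearization: $\sqrt\pi\,e^{y^2/4}=\int e^{-g^2+gy}\,dg$ replaces the square by a
linear exponent. Averaging over the signs first gives at most $\int e^{-g^2/2}\,dg=\sqrt{2\pi}$. -/
theorem expect_exp_sq_div_four_le {w : ι → ℝ} (hw : ∑ i, w i ^ 2 ≤ 1) :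
    𝔼 ε : ι → Bool, Real.exp ((∑ i, w i * sgn (ε i)) ^ 2 / 4) ≤ √2 := by
  have hπ : 0 < √Real.pi := Real.sqrt_pos.2 Real.pi_pos
  have h1 : √Real.pi * 𝔼 ε : ι → Bool, Real.exp ((∑ i, w i * sgn (ε i)) ^ 2 / 4) =
      ∫ g : ℝ, 𝔼 ε : ι → Bool, Real.exp (-g ^ 2 + g * ∑ i, w i * sgn (ε i)) := by
    simp only [Fintype.expect_eq_sum_div_card]
    rw [MeasureTheory.integral_div, MeasureTheory.integral_finsetSum _ fun ε _ =>
      (exp_sq_div_four_eq _).1, ← mul_div_assoc, Finset.mul_sum]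
    simp only [(exp_sq_div_four_eq _).2]
  have h2 : ∫ g : ℝ, 𝔼 ε : ι → Bool, Real.exp (-g ^ 2 + g * ∑ i, w i * sgn (ε i)) ≤
      ∫ g : ℝ, Real.exp (-(1 / 2) * g ^ 2) := by
    refine MeasureTheory.integral_mono ?_ (integrable_exp_neg_mul_sq (by norm_num)) fun g => ?_
    · simp only [Fintype.expect_eq_sum_div_card]
      exact (MeasureTheory.integrable_finsetSum _ fun ε _ => (exp_sq_div_four_eq _).1).div_const _
    · have := expect_exp_sum_sgn_le fun i => g * w i
      simp only [Real.exp_add, ← Finset.mul_expect, Finset.mul_sum, ← mul_assoc]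
      refine (mul_le_mul_of_nonneg_left this (Real.exp_pos _).le).trans ?_
      rw [← Real.exp_add, Real.exp_le_exp]
      simp only [mul_pow, ← Finset.mul_sum]
      nlinarith [sq_nonneg g]
  rw [integral_gaussian, ← h1, show Real.pi / (1 / 2) = Real.pi * 2 by ring,
    Real.sqrt_mul Real.pi_pos.le] at h2
  exact le_of_mul_le_mul_left h2 hπ

/-- For $|z|\le1$ this is Taylor's bound; for $|z|\ge1$ the factor $z^2\ge1$ makes the last term
dominate. -/
theorem exp_le_one_add_add_sq_mul_exp (z : ℝ) :
    Real.exp z ≤ 1 + z + z ^ 2 * Real.exp |z| := by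
  rcases le_total |z| 1 with h | h
  · have h1 := Real.abs_exp_sub_one_sub_id_le h
    have h2 := (abs_le.1 h1).2
    nlinarith [Real.one_le_exp (abs_nonneg z), sq_nonneg z]
  · have h1 : 1 ≤ z ^ 2 := by rw [← sq_abs]; nlinarith
    rcases le_total 0 z with h0 | h0
    · rw [abs_of_nonneg h0] at h ⊢
      nlinarith [Real.exp_pos z]
    · rw [abs_of_nonpos h0] at h ⊢
      have h3 : Real.exp z ≤ 1 := Real.exp_le_one_iff.2 h0
      have h4 := Real.add_one_le_exp (-z)
      nlinarith [Real.exp_pos (-z)]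

/-- Use $(v+1)^2\le128\,e^{(v+1)/8}$, then $\frac18+\frac1{16}\le\frac14$ and
$e^{1/4}\le\frac{181}{128}$. The constant is small enough that $181\sqrt2\le256$, as needed below.
-/
theorem sq_mul_exp_le {v : ℝ} (hv : 0 ≤ v) :
    (v + 1) ^ 2 * Real.exp ((v + 1) / 16) ≤ 181 * Real.exp (v / 4) := by
  have h1 : ((v + 1) / 8) ^ 2 / 2 ≤ Real.exp ((v + 1) / 8) := by
    have := Real.quadratic_le_exp_of_nonneg (show 0 ≤ (v + 1) / 8 by positivity)
    nlinarith
  have h2 : Real.exp (1 / 4) ≤ 181 / 128 := by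
    have h := Real.exp_one_lt_d9
    have h4 : Real.exp (1 / 4) ^ 4 = Real.exp 1 := by
      rw [← Real.exp_nat_mul]
      norm_num
    by_contra hc
    push Not at hc
    have : (181 / 128 : ℝ) ^ 4 < Real.exp (1 / 4) ^ 4 := by gcongr
    norm_num at this
    linarith
  have h3 : Real.exp (v / 4 + 1 / 4) = Real.exp (v / 4) * Real.exp (1 / 4) := Real.exp_add _ _
  have h4 : Real.exp ((v + 1) / 8) * Real.exp ((v + 1) / 16) ≤ Real.exp (v / 4 + 1 / 4) := by
    rw [← Real.exp_add, Real.exp_le_exp]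
    linarith
  calc (v + 1) ^ 2 * Real.exp ((v + 1) / 16)
      ≤ (128 * Real.exp ((v + 1) / 8)) * Real.exp ((v + 1) / 16) := by
        gcongr
        linarith
    _ ≤ 128 * (Real.exp (v / 4) * Real.exp (1 / 4)) := by rw [mul_assoc, ← h3]; gcongr
    _ ≤ 128 * (Real.exp (v / 4) * (181 / 128)) := by gcongr
    _ = 181 * Real.exp (v / 4) := by ring

/-- In a second-order expansion the linear term has mean zero, since the squared sum has mean $\sum
w_i^2$. The remainder is bounded by the exponential moment in `expect_exp_sq_div_four_le`. -/
theorem expect_exp_mul_sq_sub_le {w : ι → ℝ} (hw : ∑ i, w i ^ 2 ≤ 1) {t : ℝ} (ht : |t| ≤ 1 / 16) :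
    𝔼 ε : ι → Bool, Real.exp (t * ((∑ i, w i * sgn (ε i)) ^ 2 - ∑ i, w i ^ 2)) ≤
      Real.exp (256 * t ^ 2) := by
  have hw0 : 0 ≤ ∑ i, w i ^ 2 := Finset.sum_nonneg fun i _ => sq_nonneg _
  have key : ∀ v : ℝ, 0 ≤ v → Real.exp (t * (v - ∑ i, w i ^ 2)) ≤
      1 + t * (v - ∑ i, w i ^ 2) + t ^ 2 * (181 * Real.exp (v / 4)) := by
    intro v hv
    refine (exp_le_one_add_add_sq_mul_exp _).trans (add_le_add_right ?_ _)
    rw [mul_pow, mul_assoc]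
    refine mul_le_mul_of_nonneg_left ?_ (sq_nonneg t)
    have habs : |v - ∑ i, w i ^ 2| ≤ v + 1 := by
      rw [abs_le]
      constructor <;> linarith
    refine le_trans ?_ (sq_mul_exp_le hv)
    gcongr ?_ * Real.exp ?_
    · rw [← sq_abs]
      gcongr
    · rw [abs_mul]
      calc |t| * |v - ∑ i, w i ^ 2| ≤ 1 / 16 * (v + 1) := by gcongr
        _ = (v + 1) / 16 := by ring
  calc 𝔼 ε : ι → Bool, Real.exp (t * ((∑ i, w i * sgn (ε i)) ^ 2 - ∑ i, w i ^ 2))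
      ≤ 𝔼 ε : ι → Bool, (1 + t * ((∑ i, w i * sgn (ε i)) ^ 2 - ∑ i, w i ^ 2) +
          t ^ 2 * (181 * Real.exp ((∑ i, w i * sgn (ε i)) ^ 2 / 4))) :=
        Finset.expect_le_expect fun ε _ => key _ (sq_nonneg _)
    _ = 1 + t ^ 2 * (181 * 𝔼 ε : ι → Bool, Real.exp ((∑ i, w i * sgn (ε i)) ^ 2 / 4)) := by
        rw [Finset.expect_add_distrib, Finset.expect_add_distrib, ← Finset.mul_expect,
          Finset.expect_sub_distrib, expect_sum_sgn_sq, ← Finset.mul_expect, ← Finset.mul_expect]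
        simp
    _ ≤ 1 + t ^ 2 * 256 := by
        have h1 := expect_exp_sq_div_four_le hw
        have h2 : √2 ≤ 1.4143 := by
          rw [Real.sqrt_le_left (by norm_num)]
          norm_num
        gcongr
        linarith
    _ ≤ Real.exp (256 * t ^ 2) := by
        have := Real.add_one_le_exp (256 * t ^ 2)
        linarith

/-- The proportion of the points where `p` holds. -/
noncomputable def prob {Ω : Type*} [Fintype Ω] (p : Ω → Prop) : ℝ :=
  ({ω | p ω}.ncard : ℝ) / Fintype.card Ω

/-- Chernoff's bound: the indicator of $a<X$ is at most $e^{t(X-a)}$. -/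
theorem prob_lt_le {Ω : Type*} [Fintype Ω] (X : Ω → ℝ) (a t : ℝ) (ht : 0 ≤ t) :
    prob (fun ω => a < X ω) ≤ Real.exp (-(t * a)) * 𝔼 ω, Real.exp (t * X ω) := by
  classical
  rw [prob, Fintype.expect_eq_sum_div_card, ← mul_div_assoc, Set.ncard_eq_toFinset_card',
    Finset.mul_sum]
  gcongr
  rw [Finset.card_eq_sum_ones, Nat.cast_sum]
  refine (Finset.sum_le_sum (g := fun ω => Real.exp (-(t * a)) * Real.exp (t * X ω)) ?_).trans
    (Finset.sum_le_sum_of_subset_of_nonneg (Finset.subset_univ _) fun _ _ _ => by positivity)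
  intro ω hω
  rw [Set.mem_toFinset, Set.mem_ofPred_eq] at hω
  rw [← Real.exp_add, Nat.cast_one]
  exact Real.one_le_exp (by nlinarith)

theorem prob_mono {Ω : Type*} [Fintype Ω] {p q : Ω → Prop} (h : ∀ ω, p ω → q ω) :
    prob p ≤ prob q := by
  unfold prob
  gcongr
  · exact Set.toFinite _
  · exact h _

theorem prob_or_le {Ω : Type*} [Fintype Ω] (p q : Ω → Prop) :
    prob (fun ω => p ω ∨ q ω) ≤ prob p + prob q := by
  unfold prob
  rw [← add_div]
  gcongr
  exact_mod_cast Set.ncard_union_le {ω | p ω} {ω | q ω}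

theorem prob_exists_le {Ω I : Type*} [Fintype Ω] [Fintype I] (p : I → Ω → Prop) {b : ℝ}
    (h : ∀ i, prob (p i) ≤ b) : prob (fun ω => ∃ i, p i ω) ≤ Fintype.card I * b := by
  classical
  have h1 : prob (fun ω => ∃ i, p i ω) ≤ ∑ i, prob (p i) := by
    unfold prob
    rw [← Finset.sum_div]
    gcongr
    have : {ω | ∃ i, p i ω} = ⋃ i ∈ (Finset.univ : Finset I), {ω | p i ω} := by
      ext
      simp
    rw [this]
    exact_mod_cast Finset.set_ncard_biUnion_le Finset.univ fun i => {ω | p i ω}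
  refine h1.trans ((Finset.sum_le_card_nsmul _ _ b fun i _ => h i).trans ?_)
  simp

end Rademacher

/-! ### Concentration for the sign matrix of a random graph -/

namespace Reduction

open scoped BigOperators

/-! ### Random graphs -/

/-- The pairs of distinct vertices, in increasing order. -/
abbrev VertexPair (n : ℕ) : Type := {p : Fin n × Fin n // p.1 < p.2}

variable {n : ℕ}

/-- Graphs as families of bits. -/
noncomputable def graphEquiv (n : ℕ) : (VertexPair n → Bool) ≃ SimpleGraph (Fin n) where
  toFun ε :=
    { Adj := fun i j => (∃ h : i < j, ε ⟨(i, j), h⟩ = true) ∨ ∃ h : j < i, ε ⟨(j, i), h⟩ = true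
      symm := ⟨fun _ _ h => h.symm⟩
      loopless := ⟨fun i h => by rcases h with ⟨h, -⟩ | ⟨h, -⟩ <;> exact lt_irrefl _ h⟩ }
  invFun G := by
    classical
    exact fun p => decide (G.Adj p.1.1 p.1.2)
  left_inv ε := by
    funext ⟨⟨i, j⟩, h⟩
    have h' : i < j := h
    simp [h', h'.not_gt]
  right_inv G := by
    ext i j
    simp only [decide_eq_true_eq, exists_prop]
    constructor
    · rintro (⟨-, h⟩ | ⟨-, h⟩)
      · exact h
      · exact h.symm
    · intro h
      rcases lt_trichotomy i j with hij | rfl | hij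
      · exact Or.inl ⟨hij, h⟩
      · exact absurd h (G.loopless.irrefl i)
      · exact Or.inr ⟨hij, h.symm⟩

/-- The signed adjacency matrix with real entries. -/
noncomputable def realSign (G : SimpleGraph (Fin n)) (i j : Fin n) : ℝ := (signMatrix G i j : ℝ)

theorem realSign_comm (G : SimpleGraph (Fin n)) (i j : Fin n) :
    realSign G i j = realSign G j i := by
  have h := G.adj_comm i j
  by_cases h' : G.Adj i j
  · simp [realSign, signMatrix, h', h.1 h']
  · simp [realSign, signMatrix, h', mt h.2 h']

theorem realSign_self (G : SimpleGraph (Fin n)) (i : Fin n) : realSign G i i = -1 := by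
  simp [realSign, signMatrix]

theorem abs_realSign (G : SimpleGraph (Fin n)) (i j : Fin n) : |realSign G i j| = 1 := by
  by_cases h : G.Adj i j <;> simp [realSign, signMatrix, h]

theorem realSign_graphEquiv (ε : VertexPair n → Bool) {i j : Fin n} (h : i < j) :
    realSign (graphEquiv n ε) i j = sgn (ε ⟨(i, j), h⟩) := by
  have : (graphEquiv n ε).Adj i j ↔ ε ⟨(i, j), h⟩ = true := by
    simp [graphEquiv, h, h.not_gt]
  cases hε : ε ⟨(i, j), h⟩ <;> simp [realSign, signMatrix, this, hε, sgn]

theorem ncard_div_card_eq_prob (p : SimpleGraph (Fin n) → Prop) :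
    ({G | p G}.ncard : ℝ) / Nat.card (SimpleGraph (Fin n)) =
      prob fun ε : VertexPair n → Bool => p (graphEquiv n ε) := by
  rw [prob, ← Nat.card_eq_fintype_card, Nat.card_congr (graphEquiv n)]
  congr 2
  rw [← Set.ncard_image_of_injective {ε : VertexPair n → Bool | p (graphEquiv n ε)}
    (graphEquiv n).injective]
  congr 1
  ext G
  constructor
  · exact fun h => ⟨(graphEquiv n).symm G, by simpa using h, by simp⟩
  · rintro ⟨ε, h, rfl⟩
    exact h

theorem sum_sum_eq_sum_vertexPair (f : Fin n → Fin n → ℝ) :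
    ∑ i, ∑ j, f i j =
      ∑ p : VertexPair n, (f p.1.1 p.1.2 + f p.1.2 p.1.1) + ∑ i, f i i := by
  have h1 : ∀ g : Fin n → Fin n → ℝ,
      ∑ p : VertexPair n, g p.1.1 p.1.2 = ∑ i, ∑ j, if i < j then g i j else 0 := by
    intro g
    rw [← Fintype.sum_prod_type' (f := fun i j => if i < j then g i j else 0),
      ← Finset.sum_filter]
    exact (Finset.sum_subtype (Finset.univ.filter fun p : Fin n × Fin n => p.1 < p.2)
      (by simp) (fun p => g p.1 p.2)).symm
  rw [Finset.sum_add_distrib, h1, h1 (fun i j => f j i), Finset.sum_comm (γ := Fin n)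
    (f := fun i j => if i < j then f j i else 0)]
  rw [← Finset.sum_add_distrib, ← Finset.sum_add_distrib]
  refine Finset.sum_congr rfl fun i _ => ?_
  have h2 : f i i = ∑ j, if i = j then f i j else 0 := by simp
  rw [h2, ← Finset.sum_add_distrib, ← Finset.sum_add_distrib]
  refine Finset.sum_congr rfl fun j _ => ?_
  rcases lt_trichotomy i j with h | rfl | h
  · simp [h, h.not_gt, h.ne]
  · simp
  · simp [h, h.not_gt, h.ne']

theorem prob_lt_abs_le {Ω : Type*} [Fintype Ω] (X : Ω → ℝ) (a : ℝ) {t b : ℝ} (ht : 0 ≤ t)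
    (h₁ : 𝔼 ω, Real.exp (t * X ω) ≤ b) (h₂ : 𝔼 ω, Real.exp (-t * X ω) ≤ b) :
    prob (fun ω => a < |X ω|) ≤ 2 * (Real.exp (-(t * a)) * b) := by
  have h3 := prob_lt_le X a t ht
  have h4 := prob_lt_le (fun ω => -X ω) a t ht
  simp only [mul_neg, ← neg_mul] at h4
  have h5 := prob_or_le (fun ω => a < X ω) (fun ω => a < -X ω)
  simp only [lt_abs]
  rw [← neg_mul] at h3
  have h6 := mul_le_mul_of_nonneg_left h₁ (Real.exp_pos (-t * a)).le
  have h7 := mul_le_mul_of_nonneg_left h₂ (Real.exp_pos (-t * a)).le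
  rw [← neg_mul]
  linarith

/-- The diagonal of the sign matrix is the constant $-1$; adding $\sum x_iy_i$ cancels it and leaves
a sum of independent signs over the edges. -/
theorem bilin_graphEquiv (ε : VertexPair n → Bool) (x y : Fin n → ℝ) :
    ∑ i, ∑ j, realSign (graphEquiv n ε) i j * x i * y j + ∑ i, x i * y i =
      ∑ p : VertexPair n, (x p.1.1 * y p.1.2 + x p.1.2 * y p.1.1) * sgn (ε p) := by
  rw [sum_sum_eq_sum_vertexPair]
  simp only [realSign_self, neg_mul, one_mul, Finset.sum_neg_distrib, neg_add_cancel_right]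
  refine Finset.sum_congr rfl fun p _ => ?_
  rw [realSign_comm _ p.1.2, realSign_graphEquiv ε p.2]
  ring

/-- The tail bound for the bilinear form of the signed adjacency matrix of a random graph. -/
theorem prob_bilin_le {x y : Fin n → ℝ} (hx : ∑ i, x i ^ 2 ≤ 1) (hy : ∑ i, y i ^ 2 ≤ 1) {τ : ℝ}
    (hτ : 0 ≤ τ) :
    prob (fun ε : VertexPair n → Bool => τ <
      |∑ i, ∑ j, realSign (graphEquiv n ε) i j * x i * y j + ∑ i, x i * y i|) ≤
      2 * Real.exp (-(τ ^ 2 / 4)) := by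
  -- By $(a+b)^2\le2a^2+2b^2$ it suffices that $x_i^2y_j^2$ summed over all ordered pairs is at most
  -- $1$.
  have hc : ∑ p : VertexPair n, (x p.1.1 * y p.1.2 + x p.1.2 * y p.1.1) ^ 2 ≤ 2 := by
    have h1 : ∑ p : VertexPair n, (x p.1.1 ^ 2 * y p.1.2 ^ 2 + x p.1.2 ^ 2 * y p.1.1 ^ 2) ≤ 1 := by
      have h := sum_sum_eq_sum_vertexPair fun i j => x i ^ 2 * y j ^ 2
      rw [← Finset.sum_mul_sum] at h
      have h2 : 0 ≤ ∑ i, x i ^ 2 * y i ^ 2 := Finset.sum_nonneg fun i _ => by positivity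
      have h3 : (∑ i, x i ^ 2) * ∑ i, y i ^ 2 ≤ 1 * 1 :=
        mul_le_mul hx hy (Finset.sum_nonneg fun i _ => sq_nonneg _) zero_le_one
      linarith
    calc ∑ p : VertexPair n, (x p.1.1 * y p.1.2 + x p.1.2 * y p.1.1) ^ 2
        ≤ ∑ p : VertexPair n, 2 * (x p.1.1 ^ 2 * y p.1.2 ^ 2 + x p.1.2 ^ 2 * y p.1.1 ^ 2) :=
          Finset.sum_le_sum fun p _ => by
            nlinarith [sq_nonneg (x p.1.1 * y p.1.2 - x p.1.2 * y p.1.1)]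
      _ ≤ 2 := by
          rw [← Finset.mul_sum]
          linarith
  have hexp : ∀ t : ℝ, 𝔼 ε : VertexPair n → Bool, Real.exp (t *
      (∑ p : VertexPair n, (x p.1.1 * y p.1.2 + x p.1.2 * y p.1.1) * sgn (ε p))) ≤
      Real.exp (t ^ 2) := by
    intro t
    simp only [Finset.mul_sum, ← mul_assoc]
    refine (expect_exp_sum_sgn_le _).trans (Real.exp_le_exp.2 ?_)
    simp only [mul_pow, ← Finset.mul_sum]
    nlinarith [sq_nonneg t]
  simp only [bilin_graphEquiv]
  -- The choice $t=\tau/2$ minimizes $t^2-t\tau$.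
  refine (prob_lt_abs_le _ τ (t := τ / 2) (by positivity) (hexp _)
    ((hexp _).trans (by rw [neg_sq]))).trans (le_of_eq ?_)
  rw [← Real.exp_add]
  ring_nf

/-- The pair formed by a vertex outside a set and a vertex in the set. -/
def crossPair (S : Finset (Fin n)) (q : {i // i ∉ S} × {j // j ∈ S}) : VertexPair n :=
  if h : q.1.1 < q.2.1 then ⟨(q.1.1, q.2.1), h⟩
  else ⟨(q.2.1, q.1.1), lt_of_le_of_ne (not_lt.1 h) fun h' => q.1.2 (by
    have h2 : q.2.1 = q.1.1 := h'
    exact h2 ▸ q.2.2)⟩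

/-- Membership in `S` tells the two ends of such a pair apart, so distinct positions use distinct
edges. Hence the entries with row outside `S` and column in `S` are independent. -/
theorem crossPair_injective (S : Finset (Fin n)) : Function.Injective (crossPair S) := by
  rintro ⟨⟨i, hi⟩, ⟨j, hj⟩⟩ ⟨⟨i', hi'⟩, ⟨j', hj'⟩⟩ h
  unfold crossPair at h
  split_ifs at h <;> simp only [Subtype.mk.injEq, Prod.mk.injEq] at h <;> obtain ⟨rfl, rfl⟩ := h
  · rfl
  · exact absurd hj' hi
  · exact absurd hj hi'
  · rfl

theorem realSign_crossPair (S : Finset (Fin n)) (ε : VertexPair n → Bool)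
    (i : {i // i ∉ S}) (j : {j // j ∈ S}) :
    realSign (graphEquiv n ε) i j = sgn (ε (crossPair S (i, j))) := by
  unfold crossPair
  split_ifs with h
  · exact realSign_graphEquiv ε h
  · rw [realSign_comm]
    exact realSign_graphEquiv ε _

theorem sum_realSign_crossPair (S : Finset (Fin n)) (ε : VertexPair n → Bool) {w : Fin n → ℝ}
    (hw : ∀ j ∉ S, w j = 0) (i : {i // i ∉ S}) :
    ∑ j, realSign (graphEquiv n ε) i j * w j =
      ∑ j : {j // j ∈ S}, w j * sgn (ε (crossPair S (i, j))) := by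
  rw [← Finset.sum_subset (Finset.subset_univ S) fun j _ hj => by rw [hw j hj, mul_zero],
    ← Finset.sum_coe_sort]
  exact Finset.sum_congr rfl fun j _ => by rw [realSign_crossPair, mul_comm]

/-- The tail bound for the sum of the squared row sums outside the support. -/
theorem prob_sq_le {S : Finset (Fin n)} {w : Fin n → ℝ} (hw : ∀ j ∉ S, w j = 0)
    (hw1 : ∑ i, w i ^ 2 ≤ 1) (hn : 0 < n) {τ : ℝ} (hτ : 0 ≤ τ) (hτn : τ ≤ 32 * n) :
    prob (fun ε : VertexPair n → Bool => τ <
      |∑ i : {i // i ∉ S}, ((∑ j, realSign (graphEquiv n ε) i j * w j) ^ 2 - ∑ j, w j ^ 2)|) ≤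
      2 * Real.exp (-(τ ^ 2 / (1024 * n))) := by
  have hn' : (0 : ℝ) < n := by exact_mod_cast hn
  have hsum : ∑ j, w j ^ 2 = ∑ j : {j // j ∈ S}, w j ^ 2 := by
    rw [← Finset.sum_subset (Finset.subset_univ S) fun j _ hj => by rw [hw j hj]; simp,
      ← Finset.sum_coe_sort]
  simp only [sum_realSign_crossPair S _ hw, hsum]
  rw [hsum] at hw1
  have hexp : ∀ t : ℝ, |t| ≤ 1 / 16 → 𝔼 ε : VertexPair n → Bool, Real.exp (t *
      ∑ i : {i // i ∉ S}, ((∑ j : {j // j ∈ S}, w j * sgn (ε (crossPair S (i, j)))) ^ 2 -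
        ∑ j : {j // j ∈ S}, w j ^ 2)) ≤ Real.exp (256 * t ^ 2 * n) := by
    intro t ht
    simp only [Finset.mul_sum, Real.exp_sum]
    have h1 := expect_comp_injective (crossPair_injective S)
      fun η => ∏ i : {i // i ∉ S}, Real.exp (t *
        ((∑ j : {j // j ∈ S}, w j * sgn (η (i, j))) ^ 2 - ∑ j : {j // j ∈ S}, w j ^ 2))
    simp only [Function.comp_apply] at h1
    rw [h1, ← Fintype.expect_equiv (Equiv.curry {i // i ∉ S} {j // j ∈ S} Bool).symm
      (fun η => ∏ i : {i // i ∉ S}, Real.exp (t *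
        ((∑ j : {j // j ∈ S}, w j * sgn (η i j)) ^ 2 - ∑ j : {j // j ∈ S}, w j ^ 2))) _
        (fun η => rfl), expect_pi_prod (fun (_ : {i // i ∉ S}) (η : {j // j ∈ S} → Bool) =>
          Real.exp (t * ((∑ j : {j // j ∈ S}, w j * sgn (η j)) ^ 2 - ∑ j : {j // j ∈ S}, w j ^ 2)))]
    refine (Finset.prod_le_prod (fun _ _ => Finset.expect_nonneg fun _ _ => (Real.exp_pos _).le)
      fun _ _ => expect_exp_mul_sq_sub_le hw1 ht).trans ?_
    rw [Finset.prod_const, ← Real.exp_nat_mul, Real.exp_le_exp, mul_comm]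
    gcongr
    exact (Finset.card_univ.trans_le (Fintype.card_subtype_le _)).trans (Fintype.card_fin n).le
  -- The value $t=\tau/(512n)$ minimizes $256t^2n-t\tau$; the hypothesis $\tau\le32n$ says that it
  -- is at most $1/16$.
  have ht0 : 0 ≤ τ / (512 * n) := by positivity
  have ht : |τ / (512 * n)| ≤ 1 / 16 := by
    rw [abs_of_nonneg ht0, div_le_iff₀ (by positivity)]
    linarith
  refine (prob_lt_abs_le _ τ ht0 (hexp _ ht)
    ((hexp _ (by rwa [abs_neg])).trans (by rw [neg_sq]))).trans (le_of_eq ?_)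
  rw [← Real.exp_add]
  congr 2
  field_simp
  ring

end Reduction

/-! ### Discretization, and uniform bounds for typical graphs -/

namespace Reduction

/-! ### A net of sparse vectors -/

/-- The indices of a net of `k`-sparse vectors with coordinates in `{-m / m, …, m / m}`. -/
abbrev Net (n k m : ℕ) : Type :=
  Σ S : {S : Finset (Fin n) // S ∈ Finset.powersetCard k Finset.univ}, S.1 → Fin (2 * m + 1)

variable {n k m : ℕ}

/-- The points of the net. -/
noncomputable def Net.point (a : Net n k m) (i : Fin n) : ℝ :=
  if h : i ∈ a.1.1 then (((a.2 ⟨i, h⟩ : ℕ) : ℝ) - m) / m else 0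

theorem Net.point_eq_zero (a : Net n k m) {i : Fin n} (h : i ∉ a.1.1) : a.point i = 0 :=
  dif_neg h

theorem Net.card_support (a : Net n k m) : a.1.1.card = k :=
  (Finset.mem_powersetCard.1 a.1.2).2

theorem card_net_le (n k m : ℕ) : Fintype.card (Net n k m) ≤ (n * (2 * m + 1)) ^ k := by
  rw [Fintype.card_sigma]
  have : ∀ S : {S : Finset (Fin n) // S ∈ Finset.powersetCard k Finset.univ},
      Fintype.card (S.1 → Fin (2 * m + 1)) = (2 * m + 1) ^ k := by
    intro S
    rw [Fintype.card_fun, Fintype.card_fin, Fintype.card_coe,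
      (Finset.mem_powersetCard.1 S.2).2]
  simp only [this, Finset.sum_const, smul_eq_mul, mul_pow]
  gcongr
  rw [Finset.card_univ, Fintype.card_coe, Finset.card_powersetCard, Finset.card_univ,
    Fintype.card_fin]
  exact Nat.choose_le_pow n k

/-- Rounding is towards zero, so coordinates do not grow and the net point of a vector in the unit
ball stays in the ball. -/
theorem exists_truncation (hm : 0 < m) {x : ℝ} (hx : |x| ≤ 1) :
    ∃ c : Fin (2 * m + 1), |(((c : ℕ) : ℝ) - m) / m| ≤ |x| ∧ |x - (((c : ℕ) : ℝ) - m) / m| ≤ 1 / m := by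
  have hm' : (0 : ℝ) < m := by exact_mod_cast hm
  have hf : (⌊m * |x|⌋₊ : ℝ) ≤ m * |x| := Nat.floor_le (by positivity)
  have hf' : m * |x| < ⌊m * |x|⌋₊ + 1 := Nat.lt_floor_add_one _
  have hfm : ⌊m * |x|⌋₊ ≤ m := by
    have : (⌊m * |x|⌋₊ : ℝ) ≤ m := hf.trans (by nlinarith)
    exact_mod_cast this
  have hq : (⌊m * |x|⌋₊ : ℝ) / m ≤ |x| := by
    rw [div_le_iff₀ hm']
    linarith
  have hq' : |x| - (⌊m * |x|⌋₊ : ℝ) / m ≤ 1 / m := by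
    rw [sub_le_iff_le_add, ← add_div, le_div_iff₀ hm']
    linarith
  have hq0 : 0 ≤ (⌊m * |x|⌋₊ : ℝ) / m := by positivity
  rcases le_total 0 x with h | h
  · refine ⟨⟨m + ⌊m * |x|⌋₊, by omega⟩, ?_⟩
    have he : (((m + ⌊m * |x|⌋₊ : ℕ) : ℝ) - m) / m = (⌊m * |x|⌋₊ : ℝ) / m := by
      push_cast
      ring
    simp only [he]
    rw [abs_of_nonneg h] at *
    rw [abs_of_nonneg hq0, abs_of_nonneg (by linarith)]
    exact ⟨hq, hq'⟩
  · refine ⟨⟨m - ⌊m * |x|⌋₊, by omega⟩, ?_⟩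
    have he : (((m - ⌊m * |x|⌋₊ : ℕ) : ℝ) - m) / m = -((⌊m * |x|⌋₊ : ℝ) / m) := by
      rw [Nat.cast_sub hfm]
      ring
    simp only [he]
    rw [abs_of_nonpos h] at *
    rw [abs_neg, abs_of_nonneg hq0, abs_of_nonpos (by linarith)]
    exact ⟨hq, by linarith⟩

theorem abs_le_one_of_sum_sq_le {x : Fin n → ℝ} (hx : ∑ i, x i ^ 2 ≤ 1) (i : Fin n) :
    |x i| ≤ 1 := by
  rw [abs_le_one_iff_mul_self_le_one, ← sq]
  exact (Finset.single_le_sum (f := fun i => x i ^ 2) (fun i _ => sq_nonneg _)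
    (Finset.mem_univ i)).trans hx

theorem exists_net_point (hm : 0 < m) (hk : k ≤ n) {x : Fin n → ℝ} (hx : ∑ i, x i ^ 2 ≤ 1)
    (hxk : {i | x i ≠ 0}.ncard ≤ k) :
    ∃ a : Net n k m, ∑ i, a.point i ^ 2 ≤ 1 ∧ ∀ i, |x i - a.point i| ≤ 1 / m := by
  classical
  -- Net supports have exactly `k` elements, so the support of `x` is enlarged; this is where `k ≤
  -- n` enters.
  obtain ⟨S, hS, -, hSk⟩ := Finset.exists_subsuperset_card_eq
    (Finset.subset_univ {i | x i ≠ 0}.toFinset) (n := k)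
    (by rwa [← Set.ncard_eq_toFinset_card']) (by simpa using hk)
  choose c hc hc' using fun i => exists_truncation hm (abs_le_one_of_sum_sq_le hx i)
  let a : Net n k m := ⟨⟨S, Finset.mem_powersetCard.2 ⟨Finset.subset_univ _, hSk⟩⟩, fun i => c i⟩
  have ha : ∀ i, |a.point i| ≤ |x i| ∧ |x i - a.point i| ≤ 1 / m := by
    intro i
    by_cases h : i ∈ S
    · rw [show a.point i = (((c i : ℕ) : ℝ) - m) / m from dif_pos h]
      exact ⟨hc i, hc' i⟩
    · have hx0 : x i = 0 := by
        by_contra h0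
        exact h (hS (by simpa using h0))
      rw [show a.point i = 0 from dif_neg h, hx0]
      simp
  refine ⟨a, le_trans (Finset.sum_le_sum fun i _ => ?_) hx, fun i => (ha i).2⟩
  exact sq_le_sq.2 (ha i).1

/-! ### Typical graphs -/

/-- The graphs for which the tail bounds hold on the net. -/
def Typical (k m : ℕ) (τ σ : ℝ) (G : SimpleGraph (Fin n)) : Prop :=
  (∀ a b : Net n k m, ∑ i, a.point i ^ 2 ≤ 1 → ∑ i, b.point i ^ 2 ≤ 1 →
    |∑ i, ∑ j, realSign G i j * a.point i * b.point j + ∑ i, a.point i * b.point i| ≤ τ) ∧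
  ∀ a : Net n k m, ∑ i, a.point i ^ 2 ≤ 1 →
    |∑ i : {i // i ∉ a.1.1},
      ((∑ j, realSign G i j * a.point j) ^ 2 - ∑ j, a.point j ^ 2)| ≤ σ

theorem prob_false {Ω : Type*} [Fintype Ω] : prob (fun _ : Ω => False) = 0 := by
  simp [prob]

/-- A union bound over pairs of net points for the bilinear form, and over net points for the
squared row sums. -/
theorem prob_not_typical_le (hn : 0 < n) {τ σ : ℝ} (hτ : 0 ≤ τ) (hσ : 0 ≤ σ) (hσn : σ ≤ 32 * n) :
    prob (fun ε : VertexPair n → Bool => ¬ Typical k m τ σ (graphEquiv n ε)) ≤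
      2 * ((n * (2 * m + 1)) ^ k) ^ 2 * Real.exp (-(τ ^ 2 / 4)) +
        2 * (n * (2 * m + 1)) ^ k * Real.exp (-(σ ^ 2 / (1024 * n))) := by
  have hcard : (Fintype.card (Net n k m) : ℝ) ≤ (n * (2 * m + 1)) ^ k := by
    exact_mod_cast card_net_le n k m
  have h₁ := prob_exists_le (I := Net n k m × Net n k m) (b := 2 * Real.exp (-(τ ^ 2 / 4)))
    (fun (q : Net n k m × Net n k m) (ε : VertexPair n → Bool) => ∑ i, q.1.point i ^ 2 ≤ 1 ∧
      ∑ i, q.2.point i ^ 2 ≤ 1 ∧ τ < |∑ i, ∑ j, realSign (graphEquiv n ε) i j * q.1.point i *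
        q.2.point j + ∑ i, q.1.point i * q.2.point i|) (fun q => by
      by_cases h : ∑ i, q.1.point i ^ 2 ≤ 1 ∧ ∑ i, q.2.point i ^ 2 ≤ 1
      · exact (prob_mono fun ε h' => h'.2.2).trans (prob_bilin_le h.1 h.2 hτ)
      -- Pairs of net points that are not both in the unit ball contribute the empty event.
      · refine (prob_mono fun ε h' => h ⟨h'.1, h'.2.1⟩).trans ?_
        rw [prob_false]
        positivity)
  have h₂ := prob_exists_le (I := Net n k m) (b := 2 * Real.exp (-(σ ^ 2 / (1024 * n))))
    (fun (a : Net n k m) (ε : VertexPair n → Bool) => ∑ i, a.point i ^ 2 ≤ 1 ∧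
      σ < |∑ i : {i // i ∉ a.1.1},
        ((∑ j, realSign (graphEquiv n ε) i j * a.point j) ^ 2 - ∑ j, a.point j ^ 2)|)
      (fun a => by
      by_cases h : ∑ i, a.point i ^ 2 ≤ 1
      · exact (prob_mono fun ε h' => h'.2).trans
          (prob_sq_le (fun j hj => a.point_eq_zero hj) h hn hσ hσn)
      · refine (prob_mono fun ε h' => h h'.1).trans ?_
        rw [prob_false]
        positivity)
  refine (prob_mono fun ε h => ?_).trans ((prob_or_le _ _).trans (add_le_add (h₁.trans ?_)
    (h₂.trans ?_)))
  · by_contra hc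
    push Not at hc
    exact h ⟨fun a b ha hb => hc.1 (a, b) ha hb, fun a ha => hc.2 a ha⟩
  · rw [Fintype.card_prod, Nat.cast_mul, ← sq, mul_left_comm, ← mul_assoc]
    gcongr
  · rw [mul_left_comm, ← mul_assoc]
    gcongr

theorem abs_sum_sum_le {f : Fin n → Fin n → ℝ} {c : ℝ} (h : ∀ i j, |f i j| ≤ c) :
    |∑ i, ∑ j, f i j| ≤ n * (n * c) := by
  refine (Finset.abs_sum_le_sum_abs _ _).trans ((Finset.sum_le_card_nsmul _ _ (n * c) fun i _ =>
    (Finset.abs_sum_le_sum_abs _ _).trans ((Finset.sum_le_card_nsmul _ _ c fun j _ => h i j).trans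
      ?_)).trans ?_) <;> simp

theorem sum_mul_sq_le_of_abs_le_one {x y : Fin n → ℝ} (hx : ∑ i, x i ^ 2 ≤ 1)
    (hy : ∑ i, y i ^ 2 ≤ 1) : |∑ i, x i * y i| ≤ 1 := by
  have h := Finset.sum_mul_sq_le_sq_mul_sq Finset.univ x y
  rw [abs_le_one_iff_mul_self_le_one, ← sq]
  exact h.trans (mul_le_one₀ hx (Finset.sum_nonneg fun i _ => sq_nonneg _) hy)

section Typical

variable {G : SimpleGraph (Fin n)} {τ σ : ℝ}

/-- Beyond $\tau$, the diagonal term costs at most $1$ and replacing each vector by its net point at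
most $n^2/m\le1/4$. The mesh is so fine that bounding every entry separately suffices. -/
theorem Typical.bilin_le_of_le_one (hG : Typical k m τ σ G) (hk : k ≤ n) (hn : 0 < n)
    (hm : 4 * n ^ 3 ≤ m) {x y : Fin n → ℝ} (hx : ∑ i, x i ^ 2 ≤ 1) (hy : ∑ i, y i ^ 2 ≤ 1)
    (hxk : {i | x i ≠ 0}.ncard ≤ k) (hyk : {i | y i ≠ 0}.ncard ≤ k) :
    |∑ i, ∑ j, realSign G i j * x i * y j| ≤ τ + 2 := by
  have hm0 : 0 < m := lt_of_lt_of_le (by positivity) hm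
  obtain ⟨a, ha, hax⟩ := exists_net_point hm0 hk hx hxk
  obtain ⟨b, hb, hby⟩ := exists_net_point hm0 hk hy hyk
  have h1 := hG.1 a b ha hb
  have h2 := sum_mul_sq_le_of_abs_le_one ha hb
  have h3 : |∑ i, ∑ j, realSign G i j * (x i - a.point i) * y j| ≤ n * (n * (1 / m)) :=
    abs_sum_sum_le fun i j => by
      rw [abs_mul, abs_mul, abs_realSign, one_mul]
      exact (mul_le_of_le_one_right (abs_nonneg _) (abs_le_one_of_sum_sq_le hy j)).trans (hax i)
  have h4 : |∑ i, ∑ j, realSign G i j * a.point i * (y j - b.point j)| ≤ n * (n * (1 / m)) :=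
    abs_sum_sum_le fun i j => by
      rw [abs_mul, abs_mul, abs_realSign, one_mul]
      exact (mul_le_of_le_one_left (abs_nonneg _) (abs_le_one_of_sum_sq_le ha i)).trans (hby j)
  have h5 : ∑ i, ∑ j, realSign G i j * x i * y j =
      ∑ i, ∑ j, realSign G i j * (x i - a.point i) * y j +
      ∑ i, ∑ j, realSign G i j * a.point i * (y j - b.point j) +
      ∑ i, ∑ j, realSign G i j * a.point i * b.point j := by
    simp only [← Finset.sum_add_distrib]
    exact Finset.sum_congr rfl fun i _ => Finset.sum_congr rfl fun j _ => by ring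
  have h6 : (n : ℝ) * (n * (1 / m)) ≤ 1 / 4 := by
    have hm' : (4 * n ^ 3 : ℝ) ≤ m := by exact_mod_cast hm
    have hn' : (1 : ℝ) ≤ n := by exact_mod_cast hn
    have hm1 : (0 : ℝ) < m := by exact_mod_cast hm0
    rw [← mul_assoc, mul_one_div, div_le_iff₀ hm1]
    nlinarith [pow_le_pow_right₀ hn' (show 2 ≤ 3 by norm_num)]
  rw [h5]
  rw [abs_le] at *
  constructor <;> linarith [h1.1, h1.2, h2.1, h2.2, h3.1, h3.2, h4.1, h4.2]

theorem eq_zero_of_sum_sq_eq_zero {x : Fin n → ℝ} (h : ∑ i, x i ^ 2 = 0) (i : Fin n) :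
    x i = 0 := by
  have := (Finset.sum_eq_zero_iff_of_nonneg fun i _ => sq_nonneg (x i)).1 h i (Finset.mem_univ i)
  simpa using this

theorem sum_div_sqrt_sq_le (x : Fin n → ℝ) : ∑ i, (x i / √(∑ i, x i ^ 2)) ^ 2 ≤ 1 := by
  simp only [div_pow, ← Finset.sum_div]
  rw [Real.sq_sqrt (Finset.sum_nonneg fun i _ => sq_nonneg _)]
  exact div_self_le_one _

theorem ncard_div_le (x : Fin n → ℝ) (c : ℝ) {k : ℕ} (hx : {i | x i ≠ 0}.ncard ≤ k) :
    {i | x i / c ≠ 0}.ncard ≤ k :=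
  (Set.ncard_le_ncard (fun i (hi : x i / c ≠ 0) => (div_ne_zero_iff.1 hi).1)
    (Set.toFinite _)).trans hx

theorem Typical.bilin_le (hG : Typical k m τ σ G) (hk : k ≤ n) (hn : 0 < n)
    (hm : 4 * n ^ 3 ≤ m) {x y : Fin n → ℝ}
    (hxk : {i | x i ≠ 0}.ncard ≤ k) (hyk : {i | y i ≠ 0}.ncard ≤ k) :
    |∑ i, ∑ j, realSign G i j * x i * y j| ≤
      (τ + 2) * (√(∑ i, x i ^ 2) * √(∑ i, y i ^ 2)) := by
  rcases eq_or_ne (√(∑ i, x i ^ 2)) 0 with hx0 | hx0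
  · rw [Real.sqrt_eq_zero (Finset.sum_nonneg fun i _ => sq_nonneg _)] at hx0
    simp [eq_zero_of_sum_sq_eq_zero hx0]
  rcases eq_or_ne (√(∑ i, y i ^ 2)) 0 with hy0 | hy0
  · rw [Real.sqrt_eq_zero (Finset.sum_nonneg fun i _ => sq_nonneg _)] at hy0
    simp [eq_zero_of_sum_sq_eq_zero hy0]
  have h := hG.bilin_le_of_le_one hk hn hm (sum_div_sqrt_sq_le x) (sum_div_sqrt_sq_le y)
    (ncard_div_le x _ hxk) (ncard_div_le y _ hyk)
  have h2 : ∑ i, ∑ j, realSign G i j * (x i / √(∑ i, x i ^ 2)) * (y j / √(∑ i, y i ^ 2)) =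
      (∑ i, ∑ j, realSign G i j * x i * y j) / (√(∑ i, x i ^ 2) * √(∑ i, y i ^ 2)) := by
    simp only [Finset.sum_div]
    exact Finset.sum_congr rfl fun i _ => Finset.sum_congr rfl fun j _ => by
      field_simp
  have hp : 0 < √(∑ i, x i ^ 2) * √(∑ i, y i ^ 2) := by positivity
  rwa [h2, abs_div, abs_of_pos hp, div_le_iff₀ hp] at h

theorem abs_sum_realSign_mul_le {y : Fin n → ℝ} {c : ℝ} (h : ∀ j, |y j| ≤ c) (i : Fin n) :
    |∑ j, realSign G i j * y j| ≤ n * c := by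
  refine (Finset.abs_sum_le_sum_abs _ _).trans ((Finset.sum_le_card_nsmul _ _ c fun j _ => ?_).trans
    (by simp))
  rw [abs_mul, abs_realSign, one_mul]
  exact h j

/-- Duality: let $y$ be $Aw$ restricted to $S$. Then $\|y\|^2=\langle y,Aw\rangle\le(\tau+2)\|y\|$,
because $y$ is sparse too. -/
theorem Typical.sum_sq_support_le (hG : Typical k m τ σ G) (hk : k ≤ n) (hn : 0 < n)
    (hm : 4 * n ^ 3 ≤ m) (hτ : 0 ≤ τ) {S : Finset (Fin n)} (hS : S.card ≤ k) {w : Fin n → ℝ}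
    (hw : ∑ i, w i ^ 2 ≤ 1) (hwk : {i | w i ≠ 0}.ncard ≤ k) :
    ∑ i ∈ S, (∑ j, realSign G i j * w j) ^ 2 ≤ (τ + 2) ^ 2 := by
  classical
  set y : Fin n → ℝ := fun i => if i ∈ S then ∑ j, realSign G i j * w j else 0 with hy
  have hyk : {i | y i ≠ 0}.ncard ≤ k := by
    refine (Set.ncard_le_ncard (t := (S : Set (Fin n))) (fun i hi => ?_) (Set.toFinite _)).trans
      (by rwa [Set.ncard_coe_finset])
    by_contra h
    exact hi (if_neg h)
  have h1 : ∑ i, ∑ j, realSign G i j * y i * w j = ∑ i, y i ^ 2 := by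
    refine Finset.sum_congr rfl fun i _ => ?_
    by_cases h : i ∈ S
    · simp only [hy, h, if_true]
      rw [sq, Finset.mul_sum]
      exact Finset.sum_congr rfl fun j _ => by ring
    · simp [hy, h]
  have h2 : ∑ i ∈ S, (∑ j, realSign G i j * w j) ^ 2 = ∑ i, y i ^ 2 := by
    simp [hy, ite_pow]
  have h3 := hG.bilin_le hk hn hm hyk hwk
  have h0 : 0 ≤ ∑ i, y i ^ 2 := Finset.sum_nonneg fun i _ => sq_nonneg _
  rw [h1, abs_of_nonneg h0] at h3
  rw [h2]
  have hs := Real.sq_sqrt h0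
  have hw1 : √(∑ i, w i ^ 2) ≤ 1 := Real.sqrt_le_one.2 hw
  set q := √(∑ i, y i ^ 2)
  have hq : 0 ≤ q := Real.sqrt_nonneg _
  have h4 : q ^ 2 ≤ (τ + 2) * q := by
    rw [hs]
    refine h3.trans ?_
    gcongr
    exact mul_le_of_le_one_right hq hw1
  have h5 : q ≤ τ + 2 := by
    rcases hq.eq_or_lt with h | h
    · linarith
    · nlinarith
  rw [← hs]
  gcongr

/-- For the net point $w$ of $x$, rows outside its support deviate by at most $\sigma$, rows inside
add at most $(\tau+2)^2$, and comparing $n-k$ rows with $n$ costs $k$. Passing from $x$ to $w$ costs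
$\frac12$ in each of the two terms. -/
theorem Typical.sum_sq_le_of_le_one (hG : Typical k m τ σ G) (hk : k ≤ n) (hn : 0 < n)
    (hm : 4 * n ^ 3 ≤ m) (hτ : 0 ≤ τ) {x : Fin n → ℝ} (hx : ∑ i, x i ^ 2 ≤ 1)
    (hxk : {i | x i ≠ 0}.ncard ≤ k) :
    |∑ i, (∑ j, realSign G i j * x j) ^ 2 - n * ∑ i, x i ^ 2| ≤ σ + (τ + 2) ^ 2 + k + 1 := by
  classical
  have hm0 : 0 < m := lt_of_lt_of_le (by positivity) hm
  obtain ⟨a, ha, hax⟩ := exists_net_point hm0 hk hx hxk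
  set w := a.point with hw
  have hwk : {i | w i ≠ 0}.ncard ≤ k := by
    refine (Set.ncard_le_ncard (t := (a.1.1 : Set (Fin n))) (fun i hi => ?_)
      (Set.toFinite _)).trans (by rw [Set.ncard_coe_finset, a.card_support])
    by_contra h
    exact hi (a.point_eq_zero h)
  have h1 := hG.2 a ha
  have h2 := hG.sum_sq_support_le hk hn hm hτ a.card_support.le ha hwk
  have h2' : 0 ≤ ∑ i ∈ a.1.1, (∑ j, realSign G i j * w j) ^ 2 :=
    Finset.sum_nonneg fun i _ => sq_nonneg _
  have hW : 0 ≤ ∑ i, w i ^ 2 := Finset.sum_nonneg fun i _ => sq_nonneg _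
  have h3 : ∑ i, (∑ j, realSign G i j * w j) ^ 2 - n * ∑ i, w i ^ 2 =
      ∑ i : {i // i ∉ a.1.1}, ((∑ j, realSign G i j * w j) ^ 2 - ∑ j, w j ^ 2) +
        ∑ i ∈ a.1.1, (∑ j, realSign G i j * w j) ^ 2 - k * ∑ i, w i ^ 2 := by
    have e1 : ∑ i : {i // i ∉ a.1.1}, ((∑ j, realSign G i j * w j) ^ 2 - ∑ j, w j ^ 2) =
        ∑ i ∈ a.1.1ᶜ, ((∑ j, realSign G i j * w j) ^ 2 - ∑ j, w j ^ 2) :=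
      (Finset.sum_subtype _ (by simp)
        fun i => (∑ j, realSign G i j * w j) ^ 2 - ∑ j, w j ^ 2).symm
    have e2 := Finset.sum_add_sum_compl a.1.1
      fun i => ((∑ j, realSign G i j * w j) ^ 2 - ∑ j, w j ^ 2)
    rw [e1]
    rw [Finset.sum_sub_distrib, Finset.sum_sub_distrib (s := Finset.univ)] at e2
    simp only [Finset.sum_const, a.card_support, Finset.card_univ, Fintype.card_fin,
      nsmul_eq_mul] at e2
    linarith
  have hx1 := abs_le_one_of_sum_sq_le hx
  have hw1 := abs_le_one_of_sum_sq_le ha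
  have h4 : |∑ i, (∑ j, realSign G i j * x j) ^ 2 - ∑ i, (∑ j, realSign G i j * w j) ^ 2| ≤
      n * ((n * (1 / m)) * (n * 2)) := by
    rw [← Finset.sum_sub_distrib]
    refine (Finset.abs_sum_le_sum_abs _ _).trans ((Finset.sum_le_card_nsmul _ _
      ((n * (1 / m)) * (n * 2) : ℝ) fun i _ => ?_).trans (by simp))
    have e : (∑ j, realSign G i j * x j) ^ 2 - (∑ j, realSign G i j * w j) ^ 2 =
        (∑ j, realSign G i j * (x j - w j)) * ∑ j, realSign G i j * (x j + w j) := by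
      simp only [mul_sub, mul_add, Finset.sum_sub_distrib, Finset.sum_add_distrib]
      ring
    rw [e, abs_mul]
    refine mul_le_mul (abs_sum_realSign_mul_le hax i) (abs_sum_realSign_mul_le (fun j => ?_) i)
      (abs_nonneg _) (by positivity)
    exact (abs_add_le _ _).trans (by linarith [hx1 j, hw1 j])
  have h5 : |∑ i, x i ^ 2 - ∑ i, w i ^ 2| ≤ n * ((1 / m) * 2) := by
    rw [← Finset.sum_sub_distrib]
    refine (Finset.abs_sum_le_sum_abs _ _).trans ((Finset.sum_le_card_nsmul _ _
      ((1 / m) * 2 : ℝ) fun i _ => ?_).trans (by simp))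
    rw [sq_sub_sq, mul_comm, abs_mul]
    exact mul_le_mul (hax i) ((abs_add_le _ _).trans (by linarith [hx1 i, hw1 i]))
      (abs_nonneg _) (by positivity)
  have hm' : (4 * n ^ 3 : ℝ) ≤ m := by exact_mod_cast hm
  have hn' : (1 : ℝ) ≤ n := by exact_mod_cast hn
  have hm1 : (0 : ℝ) < m := by exact_mod_cast hm0
  have hp := pow_le_pow_right₀ hn' (show 2 ≤ 3 by norm_num)
  have h6 : (n : ℝ) * ((n * (1 / m)) * (n * 2)) ≤ 1 / 2 := by
    rw [show (n : ℝ) * ((n * (1 / m)) * (n * 2)) = 2 * n ^ 3 / m by ring, div_le_iff₀ hm1]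
    linarith
  have h7 : (n : ℝ) * |∑ i, x i ^ 2 - ∑ i, w i ^ 2| ≤ 1 / 2 := by
    refine (mul_le_mul_of_nonneg_left h5 (by positivity)).trans ?_
    rw [show (n : ℝ) * (n * ((1 / m) * 2)) = 2 * n ^ 2 / m by ring, div_le_iff₀ hm1]
    linarith
  rw [← Nat.abs_cast n, ← abs_mul, mul_sub] at h7
  have h8 : (k : ℝ) * ∑ i, w i ^ 2 ≤ k := mul_le_of_le_one_right (by positivity) ha
  have h9 : 0 ≤ (k : ℝ) * ∑ i, w i ^ 2 := by positivity
  rw [abs_le] at *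
  constructor <;> linarith [h1.1, h1.2, h4.1, h4.2, h7.1, h7.2, sq_nonneg (τ + 2)]

theorem Typical.sum_sq_le (hG : Typical k m τ σ G) (hk : k ≤ n) (hn : 0 < n)
    (hm : 4 * n ^ 3 ≤ m) (hτ : 0 ≤ τ) {x : Fin n → ℝ} (hxk : {i | x i ≠ 0}.ncard ≤ k) :
    |∑ i, (∑ j, realSign G i j * x j) ^ 2 - n * ∑ i, x i ^ 2| ≤
      (σ + (τ + 2) ^ 2 + k + 1) * ∑ i, x i ^ 2 := by
  have h0 : 0 ≤ ∑ i, x i ^ 2 := Finset.sum_nonneg fun i _ => sq_nonneg _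
  rcases h0.eq_or_lt with hx0 | hx0
  · simp [eq_zero_of_sum_sq_eq_zero hx0.symm]
  have h := hG.sum_sq_le_of_le_one hk hn hm hτ (sum_div_sqrt_sq_le x) (ncard_div_le x _ hxk)
  have h2 : ∑ i, (∑ j, realSign G i j * (x j / √(∑ i, x i ^ 2))) ^ 2 -
      n * ∑ i, (x i / √(∑ i, x i ^ 2)) ^ 2 =
      (∑ i, (∑ j, realSign G i j * x j) ^ 2 - n * ∑ i, x i ^ 2) / ∑ i, x i ^ 2 := by
    simp only [← mul_div_assoc, ← Finset.sum_div, div_pow, Real.sq_sqrt h0]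
    rw [sub_div, mul_div_assoc]
  rwa [h2, abs_div, abs_of_pos hx0, div_le_iff₀ hx0] at h

end Typical

end Reduction

/-! ### From typical graphs and from cliques to the RIP parameter -/

namespace Reduction

/-! ### The restricted isometry property of the matrix of a graph -/

variable {n : ℕ}

theorem sum_fin_mul_two {M : Type*} [AddCommMonoid M] (f : Fin (n * 2) → M) :
    ∑ p, f p = ∑ i, (f (finProdFinEquiv (i, 0)) + f (finProdFinEquiv (i, 1))) := by
  rw [← finProdFinEquiv.sum_comp, Fintype.sum_prod_type]
  simp only [Fin.sum_univ_two]

/-- The squared norm of `x + A y / u`. -/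
noncomputable def imageSq (G : SimpleGraph (Fin n)) (x y : Fin n → ℝ) : ℝ :=
  ∑ i, (x i + (sqrtUp n : ℝ)⁻¹ * ∑ j, realSign G i j * y j) ^ 2

theorem imageSq_eq (G : SimpleGraph (Fin n)) (x y : Fin n → ℝ) :
    imageSq G x y = ∑ i, x i ^ 2 +
      2 * (sqrtUp n : ℝ)⁻¹ * ∑ i, ∑ j, realSign G i j * x i * y j +
      (sqrtUp n : ℝ)⁻¹ ^ 2 * ∑ i, (∑ j, realSign G i j * y j) ^ 2 := by
  rw [imageSq, Finset.mul_sum, Finset.mul_sum, ← Finset.sum_add_distrib, ← Finset.sum_add_distrib]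
  refine Finset.sum_congr rfl fun i _ => ?_
  have : ∑ j, realSign G i j * x i * y j = x i * ∑ j, realSign G i j * y j := by
    rw [Finset.mul_sum]
    exact Finset.sum_congr rfl fun j _ => by ring
  rw [this]
  ring

/-- The matrix is real, so real and imaginary parts separate and all estimates reduce to real
vectors. -/
theorem normSq_ripMatrix (G : SimpleGraph (Fin n)) (z : EuclideanSpace ℂ (Fin (n * 2))) :
    ‖Matrix.toEuclideanLin ((ripMatrix G).map ((↑) : ℚ → ℂ)) z‖ ^ 2 =
      imageSq G (fun i => (z (finProdFinEquiv (i, 1))).re)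
        (fun j => (z (finProdFinEquiv (j, 0))).re) +
      imageSq G (fun i => (z (finProdFinEquiv (i, 1))).im)
        (fun j => (z (finProdFinEquiv (j, 0))).im) := by
  have h0 : ∀ i, Matrix.toEuclideanLin ((ripMatrix G).map ((↑) : ℚ → ℂ)) z
      (finProdFinEquiv (i, 0)) = 0 := by
    intro i
    simp [Matrix.toLpLin_apply, Matrix.mulVec, dotProduct, ripMatrix]
  have h1 : ∀ i, Matrix.toEuclideanLin ((ripMatrix G).map ((↑) : ℚ → ℂ)) z
      (finProdFinEquiv (i, 1)) = z (finProdFinEquiv (i, 1)) +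
        ((sqrtUp n : ℝ)⁻¹ : ℝ) * ∑ j, (realSign G i j : ℂ) * z (finProdFinEquiv (j, 0)) := by
    intro i
    rw [Matrix.toLpLin_apply]
    simp only [Matrix.mulVec, dotProduct, sum_fin_mul_two, Finset.sum_add_distrib]
    rw [add_comm]
    congr 1
    · simp [ripMatrix, apply_ite (Rat.cast : ℚ → ℂ), ite_mul]
    · rw [Finset.mul_sum]
      refine Finset.sum_congr rfl fun j _ => ?_
      simp [ripMatrix, realSign]
      ring
  rw [EuclideanSpace.norm_sq_eq, sum_fin_mul_two]
  simp only [h0, h1, norm_zero]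
  rw [imageSq, imageSq, ← Finset.sum_add_distrib]
  refine Finset.sum_congr rfl fun i _ => ?_
  rw [← Complex.normSq_eq_norm_sq, Complex.normSq_apply]
  simp only [Complex.add_re, Complex.add_im, Complex.re_ofReal_mul, Complex.im_ofReal_mul,
    Complex.re_sum, Complex.im_sum]
  ring

theorem normSq_split (z : EuclideanSpace ℂ (Fin (n * 2))) :
    ‖z‖ ^ 2 =
      (∑ i, (z (finProdFinEquiv (i, 1))).re ^ 2 + ∑ j, (z (finProdFinEquiv (j, 0))).re ^ 2) +
      (∑ i, (z (finProdFinEquiv (i, 1))).im ^ 2 + ∑ j, (z (finProdFinEquiv (j, 0))).im ^ 2) := by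
  rw [EuclideanSpace.norm_sq_eq, sum_fin_mul_two]
  simp only [← Finset.sum_add_distrib]
  refine Finset.sum_congr rfl fun i _ => ?_
  rw [← Complex.normSq_eq_norm_sq, Complex.normSq_apply, ← Complex.normSq_eq_norm_sq,
    Complex.normSq_apply]
  ring

theorem ncard_coord_le {k : ℕ} {z : EuclideanSpace ℂ (Fin (n * 2))} (hz : IsSparse k z)
    (c : Fin 2) (φ : ℂ → ℝ) (hφ : φ 0 = 0) :
    {i : Fin n | φ (z (finProdFinEquiv (i, c))) ≠ 0}.ncard ≤ k := by
  refine le_trans ?_ hz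
  refine Set.ncard_le_ncard_of_injOn (fun i => finProdFinEquiv (i, c)) ?_ ?_ (Set.toFinite _)
  · intro i hi h
    exact hi (by rw [h, hφ])
  · intro i _ j _ h
    simpa using h

theorem sqrtUp_bounds (hn : 0 < n) : √(n : ℝ) ≤ sqrtUp n ∧ (sqrtUp n : ℝ) ≤ √n + 1 ∧
    (sqrtUp n : ℝ) ^ 2 ≤ n + 2 * sqrtUp n := by
  have h1 : (n : ℝ) ≤ (sqrtUp n : ℝ) ^ 2 := by
    rw [sq]
    exact_mod_cast le_sqrtUp_mul_self n
  have hu := sqrtUp_pos hn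
  have h2 : ((sqrtUp n : ℝ) - 1) ^ 2 ≤ n := by
    have := (mul_self_lt_of_lt_sqrtUp (show sqrtUp n - 1 < sqrtUp n by omega)).le
    have h : (((sqrtUp n - 1) * (sqrtUp n - 1) : ℕ) : ℝ) ≤ n := by exact_mod_cast this
    rw [Nat.cast_mul, Nat.cast_sub hu, Nat.cast_one] at h
    linarith
  refine ⟨Real.sqrt_le_iff.2 ⟨by positivity, h1⟩, ?_, by nlinarith⟩
  have := Real.le_sqrt_of_sq_le h2
  linarith

/-- There are three errors: the cross term, $(\tau+2)/\sqrt n$ after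
$2\|x\|\|y\|\le\|x\|^2+\|y\|^2$; the deviation of $\|Ay\|^2$ from $n\|y\|^2$; and $1-n/u^2\le2/\sqrt
n$, because $u$ is rounded up to an integer. -/
theorem Typical.abs_imageSq_sub_le {k m : ℕ} {τ σ : ℝ} {G : SimpleGraph (Fin n)}
    (hG : Typical k m τ σ G) (hk : k ≤ n) (hn : 0 < n) (hm : 4 * n ^ 3 ≤ m) (hτ : 0 ≤ τ)
    (hσ : 0 ≤ σ) {x y : Fin n → ℝ} (hx : {i | x i ≠ 0}.ncard ≤ k)
    (hy : {i | y i ≠ 0}.ncard ≤ k) :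
    |imageSq G x y - (∑ i, x i ^ 2 + ∑ i, y i ^ 2)| ≤
      ((τ + 4) / √n + (σ + (τ + 2) ^ 2 + k + 1) / n) * (∑ i, x i ^ 2 + ∑ i, y i ^ 2) := by
  obtain ⟨hu1, -, hu2⟩ := sqrtUp_bounds hn
  have hn' : (0 : ℝ) < n := by exact_mod_cast hn
  have hs : 0 < √(n : ℝ) := Real.sqrt_pos.2 hn'
  have hb := hG.bilin_le hk hn hm hx hy
  have hq := hG.sum_sq_le hk hn hm hτ hy
  have hX : 0 ≤ ∑ i, x i ^ 2 := Finset.sum_nonneg fun i _ => sq_nonneg _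
  have hY : 0 ≤ ∑ i, y i ^ 2 := Finset.sum_nonneg fun i _ => sq_nonneg _
  rw [imageSq_eq]
  have hxy : √(∑ i, x i ^ 2) * √(∑ i, y i ^ 2) ≤ (∑ i, x i ^ 2 + ∑ i, y i ^ 2) / 2 := by
    nlinarith [Real.sq_sqrt hX, Real.sq_sqrt hY,
      sq_nonneg (√(∑ i, x i ^ 2) - √(∑ i, y i ^ 2))]
  set X := ∑ i, x i ^ 2
  set Y := ∑ i, y i ^ 2
  set b := ∑ i, ∑ j, realSign G i j * x i * y j
  set q := ∑ i, (∑ j, realSign G i j * y j) ^ 2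
  set u : ℝ := (sqrtUp n : ℝ) with hu_def
  have hu : 0 < u := hs.trans_le hu1
  have hinv : u⁻¹ ≤ (√(n : ℝ))⁻¹ := by gcongr
  have hinv2 : u⁻¹ ^ 2 ≤ (n : ℝ)⁻¹ := by
    rw [inv_pow]
    gcongr
    exact (Real.sqrt_le_left hu.le).1 hu1
  have h1 : |2 * u⁻¹ * b| ≤ (τ + 2) / √n * (X + Y) := by
    rw [abs_mul, abs_of_pos (show 0 < 2 * u⁻¹ by positivity)]
    calc 2 * u⁻¹ * |b| ≤ 2 * (√(n : ℝ))⁻¹ * ((τ + 2) * ((X + Y) / 2)) := by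
          gcongr
          exact hb.trans (by gcongr)
      _ = (τ + 2) / √n * (X + Y) := by ring
  have h2 : |u⁻¹ ^ 2 * (q - n * Y)| ≤ (σ + (τ + 2) ^ 2 + k + 1) / n * (X + Y) := by
    rw [abs_mul, abs_of_pos (show 0 < u⁻¹ ^ 2 by positivity)]
    calc u⁻¹ ^ 2 * |q - n * Y| ≤ (n : ℝ)⁻¹ * ((σ + (τ + 2) ^ 2 + k + 1) * (X + Y)) := by
          gcongr
          exact hq.trans (by gcongr; linarith)
      _ = (σ + (τ + 2) ^ 2 + k + 1) / n * (X + Y) := by ring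
  have h3 : |(u⁻¹ ^ 2 * n - 1) * Y| ≤ 2 / √n * (X + Y) := by
    have h4 : |u⁻¹ ^ 2 * n - 1| ≤ 2 / √n := by
      have h5 : u⁻¹ ^ 2 * n ≤ 1 := by
        calc u⁻¹ ^ 2 * n ≤ (n : ℝ)⁻¹ * n := by gcongr
          _ = 1 := inv_mul_cancel₀ hn'.ne'
      have h6 : 1 - u⁻¹ ^ 2 * n ≤ 2 * u⁻¹ := by
        have h7 : 1 - u⁻¹ ^ 2 * n = u⁻¹ ^ 2 * (u ^ 2 - n) := by field_simp
        rw [h7]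
        calc u⁻¹ ^ 2 * (u ^ 2 - n) ≤ u⁻¹ ^ 2 * (2 * u) := by
              gcongr
              linarith
          _ = 2 * u⁻¹ := by field_simp
      rw [abs_of_nonpos (by linarith), neg_sub]
      refine h6.trans ?_
      rw [div_eq_mul_inv]
      gcongr
    rw [abs_mul, abs_of_nonneg hY]
    gcongr
    linarith
  have e : X + 2 * u⁻¹ * b + u⁻¹ ^ 2 * q - (X + Y) =
      2 * u⁻¹ * b + u⁻¹ ^ 2 * (q - n * Y) + (u⁻¹ ^ 2 * n - 1) * Y := by ring
  rw [e]
  refine (abs_add_three _ _ _).trans ((add_le_add (add_le_add h1 h2) h3).trans (le_of_eq ?_))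
  ring

theorem Typical.ratRipParameter_le {k m : ℕ} {τ σ : ℝ} {G : SimpleGraph (Fin n)}
    (hG : Typical k m τ σ G) (hk : k ≤ n) (hn : 0 < n) (hm : 4 * n ^ 3 ≤ m) (hτ : 0 ≤ τ)
    (hσ : 0 ≤ σ) :
    ratRipParameter (ripMatrix G) k ≤
      (τ + 4) / √n + (σ + (τ + 2) ^ 2 + k + 1) / n := by
  refine (isLeast_ripParameter _ k).2 ⟨by positivity, fun z hz => ?_⟩
  have h1 := hG.abs_imageSq_sub_le hk hn hm hτ hσ (ncard_coord_le hz 1 Complex.re rfl)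
    (ncard_coord_le hz 0 Complex.re rfl)
  have h2 := hG.abs_imageSq_sub_le hk hn hm hτ hσ (ncard_coord_le hz 1 Complex.im rfl)
    (ncard_coord_le hz 0 Complex.im rfl)
  rw [normSq_ripMatrix, normSq_split]
  rw [abs_le] at h1 h2
  constructor <;> linarith [h1.1, h1.2, h2.1, h2.2]

/-- The vector with the coordinates `c` and `1` at the vertices of a set. -/
noncomputable def cliqueVector (s : Finset (Fin n)) (c : ℝ) : EuclideanSpace ℂ (Fin (n * 2)) :=
  WithLp.toLp 2 fun p => if (finProdFinEquiv.symm p).1 ∈ s then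
    (if (finProdFinEquiv.symm p).2 = 0 then (c : ℂ) else 1) else 0

theorem cliqueVector_apply (s : Finset (Fin n)) (c : ℝ) (i : Fin n) (d : Fin 2) :
    cliqueVector s c (finProdFinEquiv (i, d)) =
      if i ∈ s then (if d = 0 then (c : ℂ) else 1) else 0 := by
  change (if (finProdFinEquiv.symm (finProdFinEquiv (i, d))).1 ∈ s then
    (if (finProdFinEquiv.symm (finProdFinEquiv (i, d))).2 = 0 then (c : ℂ) else 1) else 0) = _
  rw [Equiv.symm_apply_apply]

theorem isSparse_cliqueVector {s : Finset (Fin n)} {k : ℕ} (hs : s.card * 2 ≤ k) (c : ℝ) :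
    IsSparse k (cliqueVector s c) := by
  classical
  refine le_trans ?_ hs
  have h : {p | cliqueVector s c p ≠ 0} ⊆
      ((s ×ˢ (Finset.univ : Finset (Fin 2))).map finProdFinEquiv.toEmbedding : Set _) := by
    intro p hp
    have hps : (finProdFinEquiv.symm p).1 ∈ s := by
      by_contra h
      exact hp (if_neg h)
    rw [Finset.mem_coe, Finset.mem_map]
    exact ⟨finProdFinEquiv.symm p, Finset.mem_product.2 ⟨hps, Finset.mem_univ _⟩,
      Equiv.apply_symm_apply _ _⟩
  refine (Set.ncard_le_ncard h (Set.toFinite _)).trans ?_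
  rw [Set.ncard_coe_finset, Finset.card_map, Finset.card_product]
  simp

/-- The upper RIP bound for $(1_s,1_s)$ and the lower one for $(-1_s,1_s)$ are subtracted, which
removes the even terms and leaves $\frac4u\langle1_s,A1_s\rangle\le4\delta l$. The diagonal $-1$
accounts for $l^2-2l$ instead of $l^2$. -/
theorem le_ratRipParameter_of_isNClique {G : SimpleGraph (Fin n)} {s : Finset (Fin n)} {l k : ℕ}
    (hs : G.IsNClique l s) (hl : 0 < l) (hk : l * 2 ≤ k) :
    ((l : ℝ) - 2) / sqrtUp n ≤ ratRipParameter (ripMatrix G) k := by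
  classical
  obtain ⟨h0, hδ⟩ := (isLeast_ripParameter ((ripMatrix G).map ((↑) : ℚ → ℂ)) k).1
  change SatisfiesRIP _ _ (ratRipParameter (ripMatrix G) k) at hδ
  set δ := ratRipParameter (ripMatrix G) k
  have hcard := hs.card_eq
  have hl' : (0 : ℝ) < l := by exact_mod_cast hl
  set x : Fin n → ℝ := fun i => if i ∈ s then 1 else 0 with hx
  have hxsq : ∑ i, x i ^ 2 = l := by simp [hx, ite_pow, hcard]
  have hA : ∑ i, ∑ j, realSign G i j * x i * x j = l * l - 2 * l := by
    have h1 : ∀ i ∈ s, ∀ j ∈ s, realSign G i j = 1 - if i = j then 2 else 0 := by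
      intro i hi j hj
      by_cases h : i = j
      · subst h
        rw [realSign_self, if_pos rfl]
        norm_num
      · simp [realSign, signMatrix, hs.isClique hi hj h, h]
    calc ∑ i, ∑ j, realSign G i j * x i * x j = ∑ i ∈ s, ∑ j ∈ s, realSign G i j := by
          simp [hx, Finset.sum_ite_mem]
      _ = ∑ i ∈ s, ∑ j ∈ s, (1 - if i = j then (2 : ℝ) else 0) :=
          Finset.sum_congr rfl fun i hi => Finset.sum_congr rfl fun j hj => h1 i hi j hj
      _ = ∑ i ∈ s, ((l : ℝ) - 2) := Finset.sum_congr rfl fun i hi => by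
          simp [Finset.sum_sub_distrib, hcard, hi]
      _ = l * l - 2 * l := by
          rw [Finset.sum_const, hcard, nsmul_eq_mul]
          ring
  have hre1 : ∀ c i, ((cliqueVector s c) (finProdFinEquiv (i, 1))).re = x i := by
    intro c i
    rw [cliqueVector_apply]
    by_cases h : i ∈ s <;> simp [hx, h]
  have him1 : ∀ c i, ((cliqueVector s c) (finProdFinEquiv (i, 1))).im = 0 := by
    intro c i
    rw [cliqueVector_apply]
    by_cases h : i ∈ s <;> simp [h]
  have hre0 : ∀ c i, ((cliqueVector s c) (finProdFinEquiv (i, 0))).re = c * x i := by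
    intro c i
    rw [cliqueVector_apply]
    by_cases h : i ∈ s <;> simp [hx, h]
  have him0 : ∀ c i, ((cliqueVector s c) (finProdFinEquiv (i, 0))).im = 0 := by
    intro c i
    rw [cliqueVector_apply]
    by_cases h : i ∈ s <;> simp [h]
  have hz : imageSq G (fun _ => 0) (fun _ => 0) = 0 := by simp [imageSq]
  have hp := (hδ _ (isSparse_cliqueVector (k := k) (by rwa [hcard]) 1)).2
  have hm := (hδ _ (isSparse_cliqueVector (k := k) (by rwa [hcard]) (-1))).1
  rw [normSq_ripMatrix, normSq_split] at hp hm
  simp only [hre1, him1, hre0, him0, hz, one_mul, neg_mul, neg_sq, hxsq] at hp hm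
  have hd : imageSq G x x - imageSq G x (fun j => -x j) =
      4 * (sqrtUp n : ℝ)⁻¹ * (l * l - 2 * l) := by
    rw [imageSq_eq, imageSq_eq]
    simp only [mul_neg, Finset.sum_neg_distrib, neg_sq, hA]
    ring
  have hfin : 4 * (sqrtUp n : ℝ)⁻¹ * (l * l - 2 * l) ≤ 4 * δ * l := by
    rw [← hd]
    simp at hp hm
    linarith
  rw [div_eq_mul_inv]
  have : ((l : ℝ) - 2) * (sqrtUp n : ℝ)⁻¹ * (4 * l) ≤ δ * (4 * l) := by linarith
  exact le_of_mul_le_mul_right this (by positivity)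

end Reduction

/-! ### Choice of exponents, and the conclusion -/

namespace Reduction

/-! ### Asymptotics -/

theorem eventually_le_natCast_rpow (C : ℝ) {e : ℝ} (he : 0 < e) :
    ∀ᶠ n : ℕ in atTop, C ≤ (n : ℝ) ^ e :=
  ((tendsto_rpow_atTop he).comp tendsto_natCast_atTop_atTop).eventually_ge_atTop C

/-- The order of the restricted isometry property of the matrix of a graph on `n` vertices. -/
noncomputable def order (n : ℕ) : ℕ := ⌊((n * 2 : ℕ) : ℝ) ^ (0.6 : ℝ)⌋₊

theorem order_le (n : ℕ) : (order n : ℝ) ≤ 2 * (n : ℝ) ^ (0.6 : ℝ) := by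
  refine (Nat.floor_le (by positivity)).trans ?_
  rw [Nat.cast_mul, Nat.cast_ofNat, Real.mul_rpow (by positivity) (by norm_num), mul_comm]
  gcongr
  calc (2 : ℝ) ^ (0.6 : ℝ) ≤ 2 ^ (1 : ℝ) := Real.rpow_le_rpow_of_exponent_le (by norm_num) (by norm_num)
    _ = 2 := Real.rpow_one 2

theorem eventually_order_le : ∀ᶠ n : ℕ in atTop, order n ≤ n := by
  filter_upwards [eventually_le_natCast_rpow 2 (show (0 : ℝ) < 0.4 by norm_num),
    eventually_gt_atTop 0] with n h hn
  have hn' : (0 : ℝ) < n := by exact_mod_cast hn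
  have : (order n : ℝ) ≤ n := by
    calc (order n : ℝ) ≤ 2 * (n : ℝ) ^ (0.6 : ℝ) := order_le n
      _ ≤ (n : ℝ) ^ (0.4 : ℝ) * (n : ℝ) ^ (0.6 : ℝ) := by gcongr
      _ = n := by
        rw [← Real.rpow_add hn']
        norm_num
  exact_mod_cast this

/-- With $\tau=n^{0.305}$ and $\sigma=n^{0.805}$, both $\tau/\sqrt n$ and $\sigma/n$ equal
$n^{-0.195}$, which beats $n^{-0.19}$ with room for constants. -/
theorem eventually_deviation_le : ∀ᶠ n : ℕ in atTop,
    ((n : ℝ) ^ (0.305 : ℝ) + 4) / √n +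
      ((n : ℝ) ^ (0.805 : ℝ) + ((n : ℝ) ^ (0.305 : ℝ) + 2) ^ 2 + order n + 1) / n ≤
      ((n * 2 : ℕ) : ℝ) ^ (-0.19 : ℝ) := by
  -- Here $36=2(5+13)$: the two quotients add up to $18n^{-0.195}$, and passing from $n$ to the
  -- matrix size $2n$ costs at most a factor $2$.
  filter_upwards [eventually_le_natCast_rpow 36 (show (0 : ℝ) < 0.005 by norm_num),
    eventually_gt_atTop 0] with n h hn
  have hn1 : (1 : ℝ) ≤ n := by exact_mod_cast hn
  have hn' : (0 : ℝ) < n := by exact_mod_cast hn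
  have hτ : 1 ≤ (n : ℝ) ^ (0.305 : ℝ) := Real.one_le_rpow hn1 (by norm_num)
  have hσ : 1 ≤ (n : ℝ) ^ (0.805 : ℝ) := Real.one_le_rpow hn1 (by norm_num)
  have hτσ : ((n : ℝ) ^ (0.305 : ℝ)) ^ 2 ≤ (n : ℝ) ^ (0.805 : ℝ) := by
    rw [← Real.rpow_natCast, ← Real.rpow_mul hn'.le]
    exact Real.rpow_le_rpow_of_exponent_le hn1 (by norm_num)
  have hk : (order n : ℝ) ≤ 2 * (n : ℝ) ^ (0.805 : ℝ) := (order_le n).trans <| by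
    gcongr ?_ * ?_
    exact Real.rpow_le_rpow_of_exponent_le hn1 (by norm_num)
  have h1 : ((n : ℝ) ^ (0.305 : ℝ) + 4) / √n ≤ 5 * (n : ℝ) ^ (-0.195 : ℝ) := by
    have e : (n : ℝ) ^ (-0.195 : ℝ) = (n : ℝ) ^ (0.305 : ℝ) / √n := by
      rw [Real.sqrt_eq_rpow, ← Real.rpow_sub hn']
      norm_num
    rw [e, ← mul_div_assoc]
    gcongr
    linarith
  -- In units of $n^{0.805}$ the numerator is at most $1+9+2+1$, as $(\tau+2)^2\le9\tau^2$.
  have h2 : ((n : ℝ) ^ (0.805 : ℝ) + ((n : ℝ) ^ (0.305 : ℝ) + 2) ^ 2 + order n + 1) / n ≤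
      13 * (n : ℝ) ^ (-0.195 : ℝ) := by
    have e : (n : ℝ) ^ (-0.195 : ℝ) = (n : ℝ) ^ (0.805 : ℝ) / n := by
      rw [← Real.rpow_sub_one hn'.ne']
      norm_num
    rw [e, ← mul_div_assoc]
    gcongr
    nlinarith
  refine (add_le_add h1 h2).trans ?_
  have h3 : (n : ℝ) ^ (-0.19 : ℝ) / 2 ≤ ((n * 2 : ℕ) : ℝ) ^ (-0.19 : ℝ) := by
    rw [Nat.cast_mul, Nat.cast_ofNat, Real.mul_rpow (by positivity) (by norm_num), div_eq_mul_inv]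
    gcongr
    rw [← Real.rpow_neg_one]
    exact Real.rpow_le_rpow_of_exponent_le (by norm_num) (by norm_num)
  have h4 : (n : ℝ) ^ (-0.19 : ℝ) = (n : ℝ) ^ (0.005 : ℝ) * (n : ℝ) ^ (-0.195 : ℝ) := by
    rw [← Real.rpow_add hn']
    norm_num
  have h5 : 36 * (n : ℝ) ^ (-0.195 : ℝ) ≤ (n : ℝ) ^ (0.005 : ℝ) * (n : ℝ) ^ (-0.195 : ℝ) := by
    gcongr
  linarith

/-- The coefficient $4$ comes from the squared net size in the bilinear bound, $1024$ from the tail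
of the squared row sums, and the $1$ leaves the factor $e^{-n^{0.6}}$. -/
theorem eventually_log_le : ∀ᶠ n : ℕ in atTop,
    1 + 4 * Real.log (9 * (n : ℝ) ^ 4) ≤ (n : ℝ) ^ (0.01 : ℝ) / 1024 := by
  have hlog := ((isLittleO_log_rpow_atTop (show (0 : ℝ) < 0.01 by norm_num)).bound
    (show (0 : ℝ) < 1 / 32768 by norm_num))
  filter_upwards [tendsto_natCast_atTop_atTop.eventually hlog, eventually_gt_atTop 0,
    eventually_le_natCast_rpow (2048 * (1 + 4 * Real.log 9)) (show (0 : ℝ) < 0.01 by norm_num)]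
    with n h hn hC
  have hn' : (0 : ℝ) < n := by exact_mod_cast hn
  rw [Real.norm_eq_abs, Real.norm_eq_abs, abs_of_pos (Real.rpow_pos_of_pos hn' _)] at h
  have h2 := le_trans (le_abs_self _) h
  rw [Real.log_mul (by norm_num) (by positivity), Real.log_pow]
  push_cast
  linarith

theorem pow_eq_exp_mul_log {a : ℝ} (ha : 0 < a) (k : ℕ) : a ^ k = Real.exp (k * Real.log a) := by
  rw [Real.exp_nat_mul, Real.exp_log ha]

/-- The tail exponents $\tau^2$ and $\sigma^2/n$ are $n^{0.61}$ up to constants, while the logarithm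
of the net size is only $O(n^{0.6}\log n)$. -/
theorem eventually_prob_not_typical_le : ∀ᶠ n : ℕ in atTop,
    prob (fun ε : VertexPair n → Bool => ¬ Typical (order n) (4 * n ^ 3) ((n : ℝ) ^ (0.305 : ℝ))
      ((n : ℝ) ^ (0.805 : ℝ)) (graphEquiv n ε)) ≤ 4 * Real.exp (-(n : ℝ) ^ (0.6 : ℝ)) := by
  filter_upwards [eventually_log_le, eventually_gt_atTop 0] with n hlog hn
  have hn1 : (1 : ℝ) ≤ n := by exact_mod_cast hn
  have hn' : (0 : ℝ) < n := by exact_mod_cast hn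
  have hσ : (n : ℝ) ^ (0.805 : ℝ) ≤ 32 * n := by
    calc (n : ℝ) ^ (0.805 : ℝ) ≤ (n : ℝ) ^ (1 : ℝ) :=
          Real.rpow_le_rpow_of_exponent_le hn1 (by norm_num)
      _ ≤ 32 * n := by
        rw [Real.rpow_one]
        linarith
  refine (prob_not_typical_le hn (by positivity) (by positivity) hσ).trans ?_
  have hA : (n : ℝ) * (2 * ((4 * n ^ 3 : ℕ) : ℝ) + 1) ≤ 9 * (n : ℝ) ^ 4 := by
    push_cast
    nlinarith [pow_le_pow_right₀ hn1 (show 1 ≤ 4 by norm_num)]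
  have h9 : 1 ≤ 9 * (n : ℝ) ^ 4 := by nlinarith [one_le_pow₀ hn1 (n := 4)]
  have hL : 0 ≤ Real.log (9 * (n : ℝ) ^ 4) := Real.log_nonneg h9
  set L := Real.log (9 * (n : ℝ) ^ 4)
  have hAk : ((n : ℝ) * (2 * ((4 * n ^ 3 : ℕ) : ℝ) + 1)) ^ order n ≤
      Real.exp (2 * (n : ℝ) ^ (0.6 : ℝ) * L) := by
    calc _ ≤ (9 * (n : ℝ) ^ 4) ^ order n := by gcongr
      _ = Real.exp (order n * L) := pow_eq_exp_mul_log (by linarith) _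
      _ ≤ _ := by
        gcongr
        exact order_le n
  have e1 : ((n : ℝ) ^ (0.305 : ℝ)) ^ 2 = (n : ℝ) ^ (0.6 : ℝ) * (n : ℝ) ^ (0.01 : ℝ) := by
    rw [← Real.rpow_natCast, ← Real.rpow_mul hn'.le, ← Real.rpow_add hn']
    norm_num
  have e2 : ((n : ℝ) ^ (0.805 : ℝ)) ^ 2 / (1024 * n) =
      (n : ℝ) ^ (0.6 : ℝ) * (n : ℝ) ^ (0.01 : ℝ) / 1024 := by
    have : ((n : ℝ) ^ (0.805 : ℝ)) ^ 2 = (n : ℝ) ^ (0.6 : ℝ) * (n : ℝ) ^ (0.01 : ℝ) * n := by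
      rw [← Real.rpow_natCast, ← Real.rpow_mul hn'.le, ← Real.rpow_add hn',
        ← Real.rpow_add_one hn'.ne']
      norm_num
    rw [this]
    field_simp
  rw [e1, e2]
  have hp : 0 ≤ (n : ℝ) ^ (0.6 : ℝ) := by positivity
  have hq : 0 ≤ (n : ℝ) ^ (0.01 : ℝ) := by positivity
  have hmul := mul_le_mul_of_nonneg_left hlog hp
  have hpq := mul_nonneg hp hq
  have hpL := mul_nonneg hp hL
  have h1 : (((n : ℝ) * (2 * ((4 * n ^ 3 : ℕ) : ℝ) + 1)) ^ order n) ^ 2 *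
      Real.exp (-((n : ℝ) ^ (0.6 : ℝ) * (n : ℝ) ^ (0.01 : ℝ) / 4)) ≤
      Real.exp (-(n : ℝ) ^ (0.6 : ℝ)) := by
    calc _ ≤ Real.exp (2 * (n : ℝ) ^ (0.6 : ℝ) * L) ^ 2 *
          Real.exp (-((n : ℝ) ^ (0.6 : ℝ) * (n : ℝ) ^ (0.01 : ℝ) / 4)) := by gcongr
      _ ≤ _ := by
        rw [← Real.exp_nat_mul, ← Real.exp_add, Real.exp_le_exp]
        push_cast
        linarith
  have h2 : ((n : ℝ) * (2 * ((4 * n ^ 3 : ℕ) : ℝ) + 1)) ^ order n *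
      Real.exp (-((n : ℝ) ^ (0.6 : ℝ) * (n : ℝ) ^ (0.01 : ℝ) / 1024)) ≤
      Real.exp (-(n : ℝ) ^ (0.6 : ℝ)) := by
    calc _ ≤ Real.exp (2 * (n : ℝ) ^ (0.6 : ℝ) * L) *
          Real.exp (-((n : ℝ) ^ (0.6 : ℝ) * (n : ℝ) ^ (0.01 : ℝ) / 1024)) := by gcongr
      _ ≤ _ := by
        rw [← Real.exp_add, Real.exp_le_exp]
        linarith
  rw [mul_assoc, mul_assoc]
  linarith

theorem prob_le_one {Ω : Type*} [Fintype Ω] (p : Ω → Prop) : prob p ≤ 1 := by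
  rw [prob, ← Nat.card_eq_fintype_card]
  exact div_le_one_of_le₀ (by exact_mod_cast Set.ncard_le_card _) (by positivity)

theorem prob_true {Ω : Type*} [Fintype Ω] [Nonempty Ω] : prob (fun _ : Ω => True) = 1 := by
  simp [prob]

theorem probFalse_eq_prob (f : LabelledGraph → Bool) (n : ℕ) :
    probFalse f n = prob fun ε : VertexPair n → Bool => f ⟨n, graphEquiv n ε⟩ = false :=
  ncard_div_card_eq_prob fun G => f ⟨n, G⟩ = false

theorem tendsto_exp_neg_rpow :
    Tendsto (fun n : ℕ => 4 * Real.exp (-(n : ℝ) ^ (0.6 : ℝ))) atTop (𝓝 0) := by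
  have h : Tendsto (fun n : ℕ => (n : ℝ) ^ (0.6 : ℝ)) atTop atTop :=
    (tendsto_rpow_atTop (by norm_num)).comp tendsto_natCast_atTop_atTop
  simpa using (Real.tendsto_exp_neg_atTop_nhds_zero.comp h).const_mul 4

/-- Once $n^{1/3}\ge6$, one has $l-2\ge n^{1/3}-3\ge n^{1/3}/2$, while $u\le2\sqrt n$; the quotient
is at least $n^{-1/6}/4$. The order must reach $2l$ because the test vector carries two copies of
the clique. -/
theorem eventually_clique_bounds : ∀ᶠ n : ℕ in atTop,
    0 < ⌊(n : ℝ) ^ (1 / 2 - 1 / 6 : ℝ)⌋₊ ∧ ⌊(n : ℝ) ^ (1 / 2 - 1 / 6 : ℝ)⌋₊ * 2 ≤ order n ∧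
      ((n * 2 : ℕ) : ℝ) ^ (-(1 / 6) : ℝ) / 4 ≤
        ((⌊(n : ℝ) ^ (1 / 2 - 1 / 6 : ℝ)⌋₊ : ℝ) - 2) / sqrtUp n := by
  filter_upwards [eventually_le_natCast_rpow 6 (show (0 : ℝ) < 1 / 2 - 1 / 6 by norm_num),
    eventually_le_natCast_rpow 2 (show (0 : ℝ) < 0.6 - (1 / 2 - 1 / 6) by norm_num),
    eventually_gt_atTop 0] with n h6 h2 hn
  have hn1 : (1 : ℝ) ≤ n := by exact_mod_cast hn
  have hn' : (0 : ℝ) < n := by exact_mod_cast hn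
  have hs : 1 ≤ √(n : ℝ) := Real.one_le_sqrt.2 hn1
  have hl := Nat.sub_one_lt_floor ((n : ℝ) ^ (1 / 2 - 1 / 6 : ℝ))
  refine ⟨Nat.floor_pos.2 (by linarith), Nat.le_floor ?_, ?_⟩
  · rw [Nat.cast_mul, Nat.cast_mul, Nat.cast_ofNat]
    calc (⌊(n : ℝ) ^ (1 / 2 - 1 / 6 : ℝ)⌋₊ : ℝ) * 2
        ≤ (n : ℝ) ^ (1 / 2 - 1 / 6 : ℝ) * (n : ℝ) ^ (0.6 - (1 / 2 - 1 / 6) : ℝ) := by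
          gcongr
          exact Nat.floor_le (by positivity)
      _ = (n : ℝ) ^ (0.6 : ℝ) := by
        rw [← Real.rpow_add hn']
        norm_num
      _ ≤ ((n : ℝ) * 2) ^ (0.6 : ℝ) := by
        gcongr
        linarith
  · obtain ⟨hu1, hu2, -⟩ := sqrtUp_bounds hn
    rw [le_div_iff₀ (by linarith)]
    have h1 : ((n * 2 : ℕ) : ℝ) ^ (-(1 / 6) : ℝ) ≤ (n : ℝ) ^ (-(1 / 6) : ℝ) := by
      refine Real.rpow_le_rpow_of_nonpos hn' ?_ (by norm_num)
      rw [Nat.cast_mul, Nat.cast_ofNat]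
      linarith
    have e : (n : ℝ) ^ (-(1 / 6) : ℝ) * √n = (n : ℝ) ^ (1 / 2 - 1 / 6 : ℝ) := by
      rw [Real.sqrt_eq_rpow, ← Real.rpow_add hn']
      norm_num
    calc ((n * 2 : ℕ) : ℝ) ^ (-(1 / 6) : ℝ) / 4 * sqrtUp n
        ≤ (n : ℝ) ^ (-(1 / 6) : ℝ) / 4 * (2 * √n) := by
          gcongr
          linarith
      _ = (n : ℝ) ^ (1 / 2 - 1 / 6 : ℝ) / 2 := by
        rw [← e]
        ring
      _ ≤ _ := by linarith

end Reduction

open Reduction in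
theorem mainTheorem5 (h : HypothesisH (1 / 6)) :
    ¬ ∃ f : SquareRatMatrix → Bool,
        PolyTimeDecides encodeMatrix f ∧
        DistinguishesRIP (fun n => ⌊(n : ℝ) ^ (0.6 : ℝ)⌋₊) (fun n => (n : ℝ) ^ (-0.19 : ℝ))
          (fun n => (n : ℝ) ^ (-(1 / 6) : ℝ) / 4) f := by
  rintro ⟨f, hf, hd⟩
  -- The distinguisher is used at the matrix size $2n$. All thresholds then merge into one `N`,
  -- which is built into the machine.
  have hd' := (tendsto_id.atTop_mul_const' (show 0 < 2 by norm_num)).eventually hd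
  obtain ⟨N, hN⟩ := eventually_atTop.1 (hd'.and (eventually_order_le.and
    (eventually_deviation_le.and (eventually_clique_bounds.and (eventually_gt_atTop 0)))))
  refine h ⟨_, polyTimeDecides_of_ripMatrix N hf, fun n G hG => ?_, ?_⟩
  · obtain ⟨s, hs⟩ := hG
    rcases lt_or_ge n N with hn | hn
    · simp [hn]
    · obtain ⟨hdn, -, -, ⟨hl, hk, hhigh⟩, -⟩ := hN n hn
      have := (hdn (ripMatrix G)).2 (hhigh.trans (le_ratRipParameter_of_isNClique hs hl hk))
      simp only [id] at this
      simp [this]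
  · have hlow : ∀ᶠ n : ℕ in atTop, 1 - 4 * Real.exp (-(n : ℝ) ^ (0.6 : ℝ)) ≤
        probFalse (fun G => decide (G.1 < N) || !f ⟨G.1 * 2, ripMatrix G.2⟩) n := by
      filter_upwards [eventually_ge_atTop N, eventually_prob_not_typical_le] with n hn hp
      obtain ⟨hdn, hk, hdev, -, hn0⟩ := hN n hn
      -- Every graph is answered `false` or is not typical, so the two probabilities add up to at
      -- least $1$.
      have hor : (1 : ℝ) ≤ _ := (prob_true (Ω := VertexPair n → Bool)).symm.le.trans <|
        (prob_mono fun ε _ => ?_).trans (prob_or_le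
          (fun ε => (decide (n < N) || !f ⟨n * 2, ripMatrix (graphEquiv n ε)⟩) = false)
          (fun ε => ¬ Typical (order n) (4 * n ^ 3) ((n : ℝ) ^ (0.305 : ℝ))
            ((n : ℝ) ^ (0.805 : ℝ)) (graphEquiv n ε)))
      · rw [probFalse_eq_prob]
        linarith
      · by_cases ht : Typical (order n) (4 * n ^ 3) ((n : ℝ) ^ (0.305 : ℝ))
            ((n : ℝ) ^ (0.805 : ℝ)) (graphEquiv n ε)
        · have := (hdn (ripMatrix (graphEquiv n ε))).1 ((ht.ratRipParameter_le hk hn0 le_rfl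
            (by positivity) (by positivity)).trans hdev)
          simp only [id] at this
          simp [this, hn]
        · exact Or.inr ht
    refine tendsto_of_tendsto_of_tendsto_of_le_of_le' (by simpa using tendsto_exp_neg_rpow.const_sub 1)
      tendsto_const_nhds hlow (Eventually.of_forall fun n => ?_)
    rw [probFalse_eq_prob]
    exact prob_le_one _
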